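/- All lines are non-vertical lines in the plane $\mathbb{R}^2$, and a finite family of such lines is in nearly general position if no two of its lines are parallel. For a finite family $L$ of lines, a $k$-cell defined by $L$ is a connected component $P$ of the complement of the union of the lines such that the boundary of $P$ contains a segment of positive length from exactly $k$ of the lines. A family of $n$ lines is in convex position if it defines an $n$-cell. For integers $n \ge 2$ and $l \ge 3$, let $\mathrm{ES}_L(l,n)$ be the minimum $N$ such that every family of $N$ lines in nearly general position contains either $l$ concurrent lines or $n$ lines in convex position. **Proposition.** Let $k \ge 2$ and $l \ge 3$ be integers. If $n = 2k+2$, then $$\mathrm{ES}_L(l,n) > \frac{l-1}{2}\binom{2k-2}{k-1}^2 - \frac{l-3}{2}\binom{2k-4}{k-2}\binom{2k-2}{k-1}.$$ If $n = 2k+1$, then $$\mathrm{ES}_L(l,n) > \frac{l-1}{2}\left(\binom{2k-2}{k-1}+1\right)\binom{2k-3}{k-1} - \frac{l-3}{2}\binom{2k-4}{k-2}\binom{2k-2}{k-1}.$$ -/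

import Mathlib

namespace LinesES

/-- A non-vertical line `y = slope * x + intercept` in the coordinate plane `ℝ × ℝ`. -/
@[ext]
structure NonverticalLine where
  slope : ℝ
  intercept : ℝ

/-- The set of points of a line. -/
def NonverticalLine.points (a : NonverticalLine) : Set (ℝ × ℝ) :=
  {p | p.2 = a.slope * p.1 + a.intercept}

/-- A finite family of (non-vertical) lines is in nearly general position if no two of them are
parallel, that is, if distinct lines of the family have distinct slopes. -/
def NearlyGeneralPosition (F : Finset NonverticalLine) : Prop :=
  ∀ a ∈ F, ∀ b ∈ F, a ≠ b → a.slope ≠ b.slope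

/-- The complement of the union of the lines of a family. -/
def lineComplement (L : Finset NonverticalLine) : Set (ℝ × ℝ) :=
  (⋃ a ∈ L, a.points)ᶜ

/-- `P` is a connected component of the complement of the union of the lines of `L`. -/
def IsCell (L : Finset NonverticalLine) (P : Set (ℝ × ℝ)) : Prop :=
  ∃ x ∈ lineComplement L, P = connectedComponentIn (lineComplement L) x

/-- The boundary of `P` contains a segment of positive length from the line `a`. -/
def BoundaryUses (P : Set (ℝ × ℝ)) (a : NonverticalLine) : Prop :=
  ∃ p q : ℝ × ℝ, p ≠ q ∧ segment ℝ p q ⊆ a.points ∩ frontier P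

/-- `L` defines the `k`-cell `P`: a connected component of the complement whose boundary contains
a segment of positive length from exactly `k` of the lines of `L`. -/
def DefinesCell (L : Finset NonverticalLine) (k : ℕ) (P : Set (ℝ × ℝ)) : Prop :=
  IsCell L P ∧ {a : NonverticalLine | a ∈ L ∧ BoundaryUses P a}.ncard = k

/-- A family of `n` lines is in convex position if it defines an `n`-cell. -/
def InConvexPosition (L : Finset NonverticalLine) : Prop :=
  ∃ P : Set (ℝ × ℝ), DefinesCell L L.card P

/-- `F` contains `l` lines passing through a common point. -/
def HasConcurrent (F : Finset NonverticalLine) (l : ℕ) : Prop :=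
  ∃ S ⊆ F, S.card = l ∧ ∃ p : ℝ × ℝ, ∀ a ∈ S, p ∈ a.points

/-- `F` contains `n` lines in convex position. -/
def HasConvex (F : Finset NonverticalLine) (n : ℕ) : Prop :=
  ∃ S ⊆ F, S.card = n ∧ InConvexPosition S

/-- The minimum `N` such that every family of `N` lines in nearly general position contains
`l` concurrent lines or `n` lines in convex position. (The infimum over `ℕ` is `0` if there is no
such `N`, so a bound `c < ESL l n` with `0 ≤ c` also says that the minimum exists.) -/
noncomputable def ESL (l n : ℕ) : ℕ :=
  sInf {N : ℕ | ∀ F : Finset NonverticalLine, F.card = N → NearlyGeneralPosition F →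
    HasConcurrent F l ∨ HasConvex F n}

end LinesES

/-!
The lower bounds come from an explicit family of lines, built in the dual plane, where the line
`y = m x + b` becomes the point `(m, b)`. Concurrent lines become collinear points. Lines bound a
common cell exactly if their dual points split into those above and those below the cell so that
through each point there is a line separating the rest accordingly; this is a condition on the
orientations of triples (`ConvexLabelling`). The lines above a cell then form a cup, those below it
form a cap, and further triples restrict how the two interlock.

The classical Erdős–Szekeres sets, obtained by putting one set far to the right of and steeply above
another (`CupCapBounded.union`), have cups of at most `a` and caps of at most `b` points, and no
cell of theirs has more than `a + b` lines. At the bottom of the recursion, pairs of points are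
replaced by `l - 1` collinear points (`CapChain`): since no three concurrent lines bound a common
cell, this costs nothing in convexity and multiplies the size by about `(l - 1) / 2`
(`exists_cupCapBounded`).

The number of points is squared by a second recursion in which the roles of steep and flat chords
are exchanged, and whose points are flattened copies of such sets, called bundles (`Bundled`). As
each step places the chords between the two halves above the chords inside bundles and below all
other positive chords, a cell that takes several lines from one bundle below it and several from
another bundle above it has at most one further line (`Bundled.union`). Lines from other bundles in
a cell with lines on both sides of one bundle force the latter to be separated in the sense of
`CupCapBounded.sep`, hence few. So bundles with cups and caps of at most `k` points give cells of at
most `2 k + 1` lines. If all bundles but the last have caps of at most `k - 1` points, the bound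
improves to `2 k`, because in the extremal cells the bundle below the cell precedes the one above
it, so that it is never the last.

A lower bound for the infimum `ESL` also needs that the minimum exists. This follows from the
Erdős–Szekeres theorem on weak cups and strict caps, as a large weak cup without `l` collinear
points contains a large strict cup (`exists_forall_hasConcurrent_or_hasConvex`).
-/

namespace LinesES

variable {S T W X Y Y' C F L R A B : Finset NonverticalLine} {c : NonverticalLine → Bool}
  {l a b m n n' N k : ℕ}

/-! ### Chords of dual points and labelled convex position -/

noncomputable instance : DecidableEq NonverticalLine := Classical.decEq _

/-- The slope of the segment between the dual points `(slope, intercept)` of two lines. Two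
non-parallel lines `p`, `q` cross at the abscissa `-chord p q`. The junk value at parallel lines is
`0`; in particular `chord p p = 0`. -/
noncomputable def chord (p q : NonverticalLine) : ℝ :=
  (q.intercept - p.intercept) / (q.slope - p.slope)

lemma chord_comm (p q : NonverticalLine) : chord p q = chord q p := by
  unfold chord
  rw [← neg_sub p.intercept, ← neg_sub p.slope, neg_div_neg_eq]

/-- The orientation that three dual points, in the order of their abscissas, must have when their
lines bound a common cell and carry the labels `u`, `v`, `w`, where `true` stands for a line above
the cell and `false` for a line below it: the value is `true` for a cup and `false` for a cap. -/
def cupLabel (u v w : Bool) : Bool := if u = w then u else !v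

/-- The labelling `c` of the lines of `S` (`true`: above the cell) is compatible with a cell that
every line of `S` bounds. This is a condition on triples of dual points only: each triple is a
strict cup or a strict cap, as its labels demand. -/
def ConvexLabelling (S : Finset NonverticalLine) (c : NonverticalLine → Bool) : Prop :=
  ∀ p ∈ S, ∀ q ∈ S, ∀ r ∈ S, p.slope < q.slope → q.slope < r.slope →
    if cupLabel (c p) (c q) (c r) then chord p q < chord q r else chord q r < chord p q

lemma ConvexLabelling.mono (h : ConvexLabelling S c) (hT : T ⊆ S) : ConvexLabelling T c :=
  fun p hp q hq r hr => h p (hT hp) q (hT hq) r (hT hr)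

lemma ConvexLabelling.of_lt (h : ConvexLabelling S c) {p q r : NonverticalLine} (hp : p ∈ S)
    (hq : q ∈ S) (hr : r ∈ S) (hpq : p.slope < q.slope) (hqr : q.slope < r.slope)
    (hlt : chord p q < chord q r) : cupLabel (c p) (c q) (c r) = true := by
  by_contra hc
  have := h p hp q hq r hr hpq hqr
  rw [if_neg hc] at this
  exact lt_asymm this hlt

lemma ConvexLabelling.of_gt (h : ConvexLabelling S c) {p q r : NonverticalLine} (hp : p ∈ S)
    (hq : q ∈ S) (hr : r ∈ S) (hpq : p.slope < q.slope) (hqr : q.slope < r.slope)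
    (hlt : chord q r < chord p q) : cupLabel (c p) (c q) (c r) = false := by
  by_contra hc
  have := h p hp q hq r hr hpq hqr
  rw [if_pos (by simpa using hc)] at this
  exact lt_asymm this hlt

lemma ConvexLabelling.chord_ne (h : ConvexLabelling S c) {p q r : NonverticalLine} (hp : p ∈ S)
    (hq : q ∈ S) (hr : r ∈ S) (hpq : p.slope < q.slope) (hqr : q.slope < r.slope) :
    chord p q ≠ chord q r := by
  have := h p hp q hq r hr hpq hqr
  split_ifs at this
  · exact this.ne
  · exact this.ne'

/-- The affine map `(x, y) ↦ (x + u, y + β x + v)` of the dual plane. It keeps the order of the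
abscissas and adds `β` to every chord. -/
noncomputable def move (u v β : ℝ) (p : NonverticalLine) : NonverticalLine :=
  ⟨p.slope + u, p.intercept + β * p.slope + v⟩

lemma move_injective (u v β : ℝ) : Function.Injective (move u v β) := by
  intro p q h
  simp only [move, NonverticalLine.mk.injEq, add_left_inj] at h
  obtain ⟨h1, h2⟩ := h
  rw [h1] at h2
  ext
  · exact h1
  · linarith

lemma chord_move (u v β : ℝ) {p q : NonverticalLine} (h : p.slope ≠ q.slope) :
    chord (move u v β p) (move u v β q) = chord p q + β := by
  have : q.slope - p.slope ≠ 0 := sub_ne_zero.2 h.symm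
  simp only [chord, move]
  rw [add_sub_add_right_eq_sub, div_add' _ _ _ this]
  congr 1 <;> ring

lemma chord_translate (u v : ℝ) (p q : NonverticalLine) :
    chord (move u v 0 p) (move u v 0 q) = chord p q := by
  simp [chord, move]

lemma ConvexLabelling.of_move {u v β : ℝ} (h : ConvexLabelling (S.image (move u v β)) c) :
    ConvexLabelling S (c ∘ move u v β) := by
  intro p hp q hq r hr hpq hqr
  have := h _ (Finset.mem_image_of_mem _ hp) _ (Finset.mem_image_of_mem _ hq) _
    (Finset.mem_image_of_mem _ hr) (by simpa [move] using hpq) (by simpa [move] using hqr)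
  rw [chord_move _ _ _ hpq.ne, chord_move _ _ _ hqr.ne] at this
  simpa using this

/-- The lines of `S` pass through a common point; equivalently, their dual points lie on a common
non-vertical line. -/
def Concurrent (S : Finset NonverticalLine) : Prop :=
  ∃ t y : ℝ, ∀ a ∈ S, a.slope * t + a.intercept = y

lemma Concurrent.mono (h : Concurrent S) (hT : T ⊆ S) : Concurrent T := by
  obtain ⟨t, y, h⟩ := h
  exact ⟨t, y, fun a ha => h a (hT ha)⟩

lemma Concurrent.of_move {u v β : ℝ} (h : Concurrent (S.image (move u v β))) :
    Concurrent S := by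
  obtain ⟨t, y, h⟩ := h
  refine ⟨t + β, y - u * t - v, fun a ha => ?_⟩
  have := h _ (Finset.mem_image_of_mem _ ha)
  simp only [move] at this
  linarith

lemma Concurrent.chord_eq (h : Concurrent S) {p q r : NonverticalLine} (hp : p ∈ S)
    (hq : q ∈ S) (hr : r ∈ S) (hpq : p.slope ≠ q.slope) (hqr : q.slope ≠ r.slope) :
    chord p q = chord q r := by
  obtain ⟨t, y, h⟩ := h
  have h1 := h p hp
  have h2 := h q hq
  have h3 := h r hr
  have e1 : chord p q = -t := by
    rw [chord, div_eq_iff (sub_ne_zero.2 hpq.symm)]; linarith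
  have e2 : chord q r = -t := by
    rw [chord, div_eq_iff (sub_ne_zero.2 hqr.symm)]; linarith
  rw [e1, e2]

/-- A far translate of `R` in the direction of slope `μ` lies to the right of `L`, and all chords
between the two sets are as close to `μ` as desired. -/
lemma exists_move (L R : Finset NonverticalLine) {lo μ hi : ℝ} (h1 : lo < μ) (h2 : μ < hi) :
    ∃ u v : ℝ, ∀ p ∈ L, ∀ q ∈ R.image (move u v 0),
      p.slope < q.slope ∧ lo < chord p q ∧ chord p q < hi := by
  have key : ∀ᶠ T : ℝ in Filter.atTop, ∀ p ∈ L, ∀ q ∈ R,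
      (p.slope - q.slope < T ∧
        (lo * (q.slope - p.slope) - (q.intercept - p.intercept)) / (μ - lo) < T) ∧
        ((q.intercept - p.intercept) - hi * (q.slope - p.slope)) / (hi - μ) < T := by
    rw [Filter.eventually_all_finset]
    intro p _
    rw [Filter.eventually_all_finset]
    intro q _
    exact ((Filter.eventually_gt_atTop _).and (Filter.eventually_gt_atTop _)).and
      (Filter.eventually_gt_atTop _)
  obtain ⟨T, hT⟩ := key.exists
  refine ⟨T, μ * T, fun p hp q' hq' => ?_⟩
  obtain ⟨q, hq, rfl⟩ := Finset.mem_image.1 hq'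
  obtain ⟨⟨a1, a2⟩, a3⟩ := hT p hp q hq
  rw [div_lt_iff₀ (by linarith)] at a2 a3
  have hpos : 0 < q.slope + T - p.slope := by linarith
  simp only [chord, move]
  refine ⟨by linarith, ?_, ?_⟩
  · rw [lt_div_iff₀ hpos]; linarith
  · rw [div_lt_iff₀ hpos]; linarith

lemma exists_chord_bound (X : Finset NonverticalLine) :
    ∃ M : ℝ, 0 < M ∧ ∀ p ∈ X, ∀ q ∈ X, |chord p q| < M := by
  have key : ∀ᶠ M : ℝ in Filter.atTop, 0 < M ∧ ∀ p ∈ X, ∀ q ∈ X, |chord p q| < M := by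
    refine (Filter.eventually_gt_atTop 0).and ?_
    rw [Filter.eventually_all_finset]
    intro p _
    rw [Filter.eventually_all_finset]
    exact fun q _ => Filter.eventually_gt_atTop _
  exact key.exists

/-! ### Sets with bounded cups, caps and cells -/

/-- Distinct lines of `X` have distinct slopes. -/
def SlopeInj (X : Finset NonverticalLine) : Prop :=
  ∀ p ∈ X, ∀ q ∈ X, p.slope = q.slope → p = q

lemma SlopeInj.mono (h : SlopeInj X) (hS : S ⊆ X) : SlopeInj S :=
  fun p hp q hq => h p (hS hp) q (hS hq)

lemma SlopeInj.lt_or_gt (h : SlopeInj X) {p q : NonverticalLine} (hp : p ∈ X) (hq : q ∈ X)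
    (hne : p ≠ q) : p.slope < q.slope ∨ q.slope < p.slope :=
  lt_or_gt_of_ne fun e => hne (h p hp q hq e)

lemma SlopeInj.union (hL : SlopeInj L) (hR : SlopeInj R)
    (hx : ∀ p ∈ L, ∀ q ∈ R, p.slope < q.slope) : SlopeInj (L ∪ R) := by
  intro p hp q hq e
  rcases Finset.mem_union.1 hp with hp | hp <;> rcases Finset.mem_union.1 hq with hq | hq
  · exact hL p hp q hq e
  · exact absurd e (hx p hp q hq).ne
  · exact absurd e (hx q hq p hp).ne'
  · exact hR p hp q hq e

lemma SlopeInj.move (h : SlopeInj X) (u v β : ℝ) : SlopeInj (X.image (move u v β)) := by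
  intro p hp q hq e
  obtain ⟨p, hp', rfl⟩ := Finset.mem_image.1 hp
  obtain ⟨q, hq', rfl⟩ := Finset.mem_image.1 hq
  rw [h p hp' q hq' (by simpa [LinesES.move] using e)]

lemma disjoint_of_slope_lt (hx : ∀ p ∈ L, ∀ q ∈ R, p.slope < q.slope) : Disjoint L R :=
  Finset.disjoint_left.2 fun p hp hq => lt_irrefl _ (hx p hp p hq)

lemma card_le_one_of_ordered (hS : SlopeInj S)
    (h : ∀ p ∈ S, ∀ q ∈ S, p.slope < q.slope → False) : S.card ≤ 1 := by
  rw [Finset.card_le_one]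
  intro p hp q hq
  by_contra hne
  rcases hS.lt_or_gt hp hq hne with h1 | h1
  · exact h p hp q hq h1
  · exact h q hq p hp h1

lemma card_filter_label (S : Finset NonverticalLine) (c : NonverticalLine → Bool) :
    (S.filter (fun p => c p = true)).card + (S.filter (fun p => c p = false)).card = S.card := by
  rw [← Finset.card_filter_add_card_filter_not (s := S) (fun p => c p = true)]
  simp

lemma card_le_two_of_labels_ne (hS : SlopeInj S)
    (h : ∀ p ∈ S, ∀ q ∈ S, p.slope < q.slope → c p ≠ c q) : S.card ≤ 2 := by
  rw [← card_filter_label S c]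
  have key : ∀ w : Bool, (S.filter (fun p => c p = w)).card ≤ 1 := by
    intro w
    refine card_le_one_of_ordered (hS.mono (Finset.filter_subset _ _)) fun p hp q hq hpq => ?_
    rw [Finset.mem_filter] at hp hq
    exact h p hp.1 q hq.1 hpq (hp.2.trans hq.2.symm)
  have := key true
  have := key false
  omega

lemma card_le_two_of_labels (hS : SlopeInj S)
    (h : ∀ p ∈ S, ∀ q ∈ S, p.slope < q.slope → c p = true ∧ c q = false) : S.card ≤ 2 :=
  card_le_two_of_labels_ne (c := c) hS fun p hp q hq hpq => by
    rw [(h p hp q hq hpq).1, (h p hp q hq hpq).2]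
    decide

lemma card_le_two_of_ordered (hS : SlopeInj S) (h : ∀ p ∈ S, ∀ q ∈ S, ∀ r ∈ S,
    p.slope < q.slope → q.slope < r.slope → False) : S.card ≤ 2 := by
  rcases S.eq_empty_or_nonempty with rfl | hne
  · simp
  obtain ⟨m, hm, hmin⟩ := S.exists_min_image (fun p => p.slope) hne
  have h1 : (S.erase m).card ≤ 1 := by
    refine card_le_one_of_ordered (hS.mono (Finset.erase_subset _ _)) fun p hp q hq hpq => ?_
    rw [Finset.mem_erase] at hp hq
    refine h m hm p hp.2 q hq.2 (lt_of_le_of_ne (hmin p hp.2) fun e => hp.1 ?_) hpq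
    exact (hS m hm p hp.2 e).symm
  rw [Finset.card_erase_of_mem hm] at h1
  omega

lemma exists_split (hx : Disjoint L R) (hS : S ⊆ L ∪ R) :
    ∃ A B : Finset NonverticalLine, A ⊆ L ∧ B ⊆ R ∧ S = A ∪ B ∧ S.card = A.card + B.card := by
  have e : S = S ∩ L ∪ S ∩ R := by
    rw [← Finset.inter_union_distrib_left, Finset.inter_eq_left.2 hS]
  refine ⟨S ∩ L, S ∩ R, Finset.inter_subset_right, Finset.inter_subset_right, e, ?_⟩
  conv_lhs => rw [e]
  exact Finset.card_union_of_disjoint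
    (hx.mono Finset.inter_subset_right Finset.inter_subset_right)

/-- If no triple of dual points that meets both `L` and `R` is collinear, then a concurrent subset
of `L ∪ R` with at least three lines lies in `L` or in `R`. -/
lemma concurrent_union (hL : SlopeInj L) (hR : SlopeInj R)
    (hx : ∀ p ∈ L, ∀ q ∈ R, p.slope < q.slope) (hl : 3 ≤ l)
    (cL : ∀ S ⊆ L, Concurrent S → S.card < l) (cR : ∀ S ⊆ R, Concurrent S → S.card < l)
    (h1 : ∀ p ∈ L, ∀ q ∈ L, ∀ r ∈ R, p.slope < q.slope → chord p q ≠ chord q r)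
    (h2 : ∀ p ∈ L, ∀ q ∈ R, ∀ r ∈ R, q.slope < r.slope → chord p q ≠ chord q r) :
    ∀ S ⊆ L ∪ R, Concurrent S → S.card < l := by
  intro S hS hc
  obtain ⟨A, B, sL, sR, rfl, hsum⟩ := exists_split (disjoint_of_slope_lt hx) hS
  have mA : ∀ {p}, p ∈ A → p ∈ A ∪ B := fun h => Finset.mem_union_left _ h
  have mB : ∀ {p}, p ∈ B → p ∈ A ∪ B := fun h => Finset.mem_union_right _ h
  rcases A.eq_empty_or_nonempty with rfl | ⟨p, hp⟩
  · simpa using cR B sR (by simpa using hc)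
  rcases B.eq_empty_or_nonempty with rfl | ⟨r, hr⟩
  · simpa using cL A sL (by simpa using hc)
  have a1 : A.card ≤ 1 := card_le_one_of_ordered (hL.mono sL) fun x hx' y hy hxy =>
    h1 x (sL hx') y (sL hy) r (sR hr) hxy
      (hc.chord_eq (mA hx') (mA hy) (mB hr) hxy.ne (hx y (sL hy) r (sR hr)).ne)
  have a2 : B.card ≤ 1 := card_le_one_of_ordered (hR.mono sR) fun x hx' y hy hxy =>
    h2 p (sL hp) x (sR hx') y (sR hy) hxy
      (hc.chord_eq (mA hp) (mB hx') (mB hy) (hx p (sL hp) x (sR hx')).ne hxy.ne)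
  omega

/-- `X` has no `l` concurrent lines, its cups have at most `a` points, its caps at most `b`, and
its cells at most `a + b` lines. In addition (`sep`), a cell with lines on both sides has at most
three lines if all dual points of the lines above it precede those of the lines below it. -/
structure CupCapBounded (l a b : ℕ) (X : Finset NonverticalLine) : Prop where
  inj : SlopeInj X
  conc : ∀ S ⊆ X, Concurrent S → S.card < l
  cup : ∀ S ⊆ X, ∀ c, ConvexLabelling S c → (∀ p ∈ S, c p = true) → S.card ≤ a
  cap : ∀ S ⊆ X, ∀ c, ConvexLabelling S c → (∀ p ∈ S, c p = false) → S.card ≤ b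
  cell : ∀ S ⊆ X, ∀ c, ConvexLabelling S c → S.card ≤ a + b
  sep : ∀ S ⊆ X, ∀ c, ConvexLabelling S c →
    (∀ p ∈ S, ∀ q ∈ S, p.slope < q.slope → c p = false → c q = false) →
    (∃ p ∈ S, c p = true) → (∃ p ∈ S, c p = false) → S.card ≤ 3

lemma CupCapBounded.move {a b : ℕ} (h : CupCapBounded l a b X) (u v β : ℝ) :
    CupCapBounded l a b (X.image (move u v β)) := by
  have inj := move_injective u v β
  refine ⟨h.inj.move u v β, ?_, ?_, ?_, ?_, ?_⟩ <;> intro S hS <;>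
    obtain ⟨T, hT, rfl⟩ := Finset.subset_image_iff.1 hS <;>
    rw [Finset.card_image_of_injective _ inj]
  · exact fun hc => h.conc T hT hc.of_move
  · exact fun c hc hl => h.cup T hT _ hc.of_move
      fun p hp => hl _ (Finset.mem_image_of_mem _ hp)
  · exact fun c hc hl => h.cap T hT _ hc.of_move
      fun p hp => hl _ (Finset.mem_image_of_mem _ hp)
  · exact fun c hc => h.cell T hT _ hc.of_move
  · intro c hc hs ht hf
    refine h.sep T hT _ hc.of_move (fun p hp q hq hpq => ?_) ?_ ?_
    · exact hs _ (Finset.mem_image_of_mem _ hp) _ (Finset.mem_image_of_mem _ hq)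
        (by simpa [LinesES.move] using hpq)
    · simpa using ht
    · simpa using hf

lemma label_after_true {x y : Bool} (h : cupLabel true x y = false) : x = true ∧ y = false := by
  revert x y; decide

lemma label_before_false {x y : Bool} (h : cupLabel x y false = true) : x = true ∧ y = false := by
  revert x y; decide

lemma label_before_true {x y : Bool} (h : cupLabel x y true = true) (hx : x = false) :
    y = false := by
  revert x y; decide

/-- The step of the Erdős–Szekeres construction: `R` lies to the right of `L` and so high above it
that the chords between `L` and `R` are steeper than all others. -/
lemma CupCapBounded.union {a b : ℕ} {lo : ℝ} (hl : 3 ≤ l) (ha : 1 ≤ a) (hb : 1 ≤ b)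
    (hL : CupCapBounded l a (b + 1) L) (hR : CupCapBounded l (a + 1) b R)
    (bL : ∀ p ∈ L, ∀ q ∈ L, chord p q < lo) (bR : ∀ p ∈ R, ∀ q ∈ R, chord p q < lo)
    (hx : ∀ p ∈ L, ∀ q ∈ R, p.slope < q.slope ∧ lo < chord p q) :
    CupCapBounded l (a + 1) (b + 1) (L ∪ R) := by
  have hlt : ∀ p ∈ L, ∀ q ∈ R, p.slope < q.slope := fun p hp q hq => (hx p hp q hq).1
  have hinj := hL.inj.union hR.inj hlt
  have hdis := disjoint_of_slope_lt hlt
  -- chords inside `L` or `R` are less steep than those across: two points of `L` and one of `R`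
  -- form a cup, one point of `L` and two of `R` form a cap
  have cupLLR : ∀ A B c, A ⊆ L → B ⊆ R → ConvexLabelling (A ∪ B) c →
      ∀ p ∈ A, ∀ q ∈ A, ∀ r ∈ B, p.slope < q.slope → cupLabel (c p) (c q) (c r) = true := by
    intro A B c sL sR hc p hp q hq r hr hpq
    exact hc.of_lt (Finset.mem_union_left _ hp) (Finset.mem_union_left _ hq)
      (Finset.mem_union_right _ hr) hpq (hlt _ (sL hq) _ (sR hr))
      ((bL p (sL hp) q (sL hq)).trans (hx q (sL hq) r (sR hr)).2)
  have capLRR : ∀ A B c, A ⊆ L → B ⊆ R → ConvexLabelling (A ∪ B) c →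
      ∀ p ∈ A, ∀ q ∈ B, ∀ r ∈ B, q.slope < r.slope → cupLabel (c p) (c q) (c r) = false := by
    intro A B c sL sR hc p hp q hq r hr hqr
    exact hc.of_gt (Finset.mem_union_left _ hp) (Finset.mem_union_right _ hq)
      (Finset.mem_union_right _ hr) (hlt _ (sL hp) _ (sR hq)) hqr
      ((bR q (sR hq) r (sR hr)).trans (hx p (sL hp) q (sR hq)).2)
  refine ⟨hinj, concurrent_union hL.inj hR.inj hlt hl hL.conc hR.conc ?_ ?_, ?_, ?_, ?_, ?_⟩
  · intro p hp q hq r hr _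
    exact ((bL p hp q hq).trans (hx q hq r hr).2).ne
  · intro p hp q hq r hr _
    exact ((bR q hq r hr).trans (hx p hp q hq).2).ne'
  all_goals
    intro S hS c hc
    obtain ⟨A, B, sL, sR, rfl, hsum⟩ := exists_split hdis hS
    have mL : ∀ {p}, p ∈ A → p ∈ A ∪ B := fun h => Finset.mem_union_left _ h
    have mR : ∀ {p}, p ∈ B → p ∈ A ∪ B := fun h => Finset.mem_union_right _ h
    have iL : SlopeInj A := hL.inj.mono sL
    have iR : SlopeInj B := hR.inj.mono sR
    have cL : ConvexLabelling A c := hc.mono Finset.subset_union_left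
    have cR : ConvexLabelling B c := hc.mono Finset.subset_union_right
    specialize cupLLR A B c sL sR hc
    specialize capLRR A B c sL sR hc
  · intro hall
    rcases A.eq_empty_or_nonempty with rfl | ⟨p, hp⟩
    · have := hR.cup B sR c cR fun p hp => hall p (mR hp)
      simp only [Finset.card_empty] at hsum; omega
    have h1 := hL.cup A sL c cL fun p hp => hall p (mL hp)
    have h2 : B.card ≤ 1 := card_le_one_of_ordered iR fun q hq r hr hqr => by
      have := capLRR p hp q hq r hr hqr
      rw [hall p (mL hp), hall q (mR hq), hall r (mR hr)] at this
      exact absurd this (by decide)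
    omega
  · intro hall
    rcases B.eq_empty_or_nonempty with rfl | ⟨r, hr⟩
    · have := hL.cap A sL c cL fun p hp => hall p (mL hp)
      simp only [Finset.card_empty] at hsum; omega
    have h1 := hR.cap B sR c cR fun p hp => hall p (mR hp)
    have h2 : A.card ≤ 1 := card_le_one_of_ordered iL fun p hp q hq hpq => by
      have := cupLLR p hp q hq r hr hpq
      rw [hall p (mL hp), hall q (mL hq), hall r (mR hr)] at this
      exact absurd this (by decide)
    omega
  · have nL := hL.cell A sL c cL
    have nR := hR.cell B sR c cR
    rcases A.eq_empty_or_nonempty with rfl | ⟨p₀, hp₀⟩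
    · simp only [Finset.card_empty] at hsum; omega
    rcases B.eq_empty_or_nonempty with rfl | ⟨r₀, hr₀⟩
    · simp only [Finset.card_empty] at hsum; omega
    by_cases hAU : ∃ u ∈ A, c u = true
    · obtain ⟨u, hu, hcu⟩ := hAU
      have lR : ∀ q ∈ B, ∀ r ∈ B, q.slope < r.slope → c q = true ∧ c r = false :=
        fun q hq r hr hqr => label_after_true (hcu ▸ capLRR u hu q hq r hr hqr)
      by_cases hBD : ∃ d ∈ B, c d = false
      · obtain ⟨d, hd, hcd⟩ := hBD
        have := card_le_two_of_labels iR lR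
        have := card_le_two_of_labels iL fun p hp q hq hpq =>
          label_before_false (hcd ▸ cupLLR p hp q hq d hd hpq)
        omega
      · push Not at hBD
        have h2 : B.card ≤ 1 := card_le_one_of_ordered iR fun q hq r hr hqr =>
          hBD r hr (lR q hq r hr hqr).2
        by_cases hAD : ∃ d ∈ A, c d = false
        · have := hL.sep A sL c cL (fun p hp q hq hpq hcp => by
            have := cupLLR p hp q hq r₀ hr₀ hpq
            rw [Bool.eq_true_of_not_eq_false (hBD r₀ hr₀)] at this
            exact label_before_true this hcp) ⟨u, hu, hcu⟩ hAD
          omega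
        · push Not at hAD
          have := hL.cup A sL c cL fun p hp => Bool.eq_true_of_not_eq_false (hAD p hp)
          omega
    · push Not at hAU
      by_cases hBD : ∃ d ∈ B, c d = false
      · obtain ⟨d, hd, hcd⟩ := hBD
        have h1 : A.card ≤ 1 := card_le_one_of_ordered iL fun p hp q hq hpq =>
          hAU p hp (label_before_false (hcd ▸ cupLLR p hp q hq d hd hpq)).1
        omega
      · push Not at hBD
        have := hL.cap A sL c cL fun p hp => Bool.eq_false_of_not_eq_true (hAU p hp)
        have := hR.cup B sR c cR fun p hp => Bool.eq_true_of_not_eq_false (hBD p hp)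
        omega
  · intro hs ht hf
    have sA : ∀ p ∈ A, ∀ q ∈ A, p.slope < q.slope → c p = false → c q = false :=
      fun p hp q hq => hs p (mL hp) q (mL hq)
    have sB : ∀ p ∈ B, ∀ q ∈ B, p.slope < q.slope → c p = false → c q = false :=
      fun p hp q hq => hs p (mR hp) q (mR hq)
    have sAB : ∀ p ∈ A, ∀ q ∈ B, c p = false → c q = false :=
      fun p hp q hq => hs p (mL hp) q (mR hq) (hlt p (sL hp) q (sR hq))
    rcases A.eq_empty_or_nonempty with rfl | ⟨p₀, hp₀⟩
    · have := hR.sep B sR c cR sB (by simpa using ht) (by simpa using hf)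
      simp only [Finset.card_empty] at hsum; omega
    rcases B.eq_empty_or_nonempty with rfl | ⟨r₀, hr₀⟩
    · have := hL.sep A sL c cL sA (by simpa using ht) (by simpa using hf)
      simp only [Finset.card_empty] at hsum; omega
    by_cases hAU : ∃ u ∈ A, c u = true
    · obtain ⟨u, hu, hcu⟩ := hAU
      have lR : ∀ q ∈ B, ∀ r ∈ B, q.slope < r.slope → c q = true ∧ c r = false :=
        fun q hq r hr hqr => label_after_true (hcu ▸ capLRR u hu q hq r hr hqr)
      have hBD : ∃ d ∈ B, c d = false := by
        by_contra hBD
        push Not at hBD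
        obtain ⟨f, hf, hcf⟩ := hf
        rcases Finset.mem_union.1 hf with hf | hf
        · exact hBD r₀ hr₀ (sAB f hf r₀ hr₀ hcf)
        · exact hBD f hf hcf
      obtain ⟨d, hd, hcd⟩ := hBD
      have lL : ∀ p ∈ A, ∀ q ∈ A, p.slope < q.slope → c p = true ∧ c q = false :=
        fun p hp q hq hpq => label_before_false (hcd ▸ cupLLR p hp q hq d hd hpq)
      have := card_le_two_of_labels iR lR
      have := card_le_two_of_labels iL lL
      by_cases hAD : ∃ d ∈ A, c d = false
      · obtain ⟨e, he, hce⟩ := hAD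
        have : B.card ≤ 1 := card_le_one_of_ordered iR fun q hq r hr hqr => by
          have h1 := (lR q hq r hr hqr).1
          rw [sAB e he q hq hce] at h1
          exact absurd h1 (by decide)
        omega
      · push Not at hAD
        have : A.card ≤ 1 := card_le_one_of_ordered iL fun p hp q hq hpq =>
          hAD q hq (lL p hp q hq hpq).2
        omega
    · push Not at hAU
      obtain ⟨u, hu, hcu⟩ := ht
      rcases Finset.mem_union.1 hu with hu | hu
      · exact absurd hcu (hAU u hu)
      · rw [sAB p₀ hp₀ u hu (Bool.eq_false_of_not_eq_true (hAU p₀ hp₀))] at hcu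
        exact absurd hcu (by decide)

/-! ### Collinear groups and the size of the sets of bounded cups and caps -/

/-- The half-turn of the dual plane. It keeps the slopes of chords and exchanges cups and caps. -/
def rot (p : NonverticalLine) : NonverticalLine := ⟨-p.slope, -p.intercept⟩

lemma rot_injective : Function.Injective rot := by
  intro p q h
  simpa [rot, NonverticalLine.ext_iff] using h

lemma chord_rot (p q : NonverticalLine) : chord (rot p) (rot q) = chord p q := by
  rw [chord_comm p q]
  simp only [chord, rot, neg_sub_neg]

lemma ConvexLabelling.of_rot (h : ConvexLabelling (S.image rot) c) :
    ConvexLabelling S (fun p => !c (rot p)) := by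
  intro p hp q hq r hr hpq hqr
  have := h _ (Finset.mem_image_of_mem _ hr) _ (Finset.mem_image_of_mem _ hq) _
    (Finset.mem_image_of_mem _ hp) (by simpa [rot] using hqr) (by simpa [rot] using hpq)
  rw [chord_rot, chord_rot, chord_comm r q, chord_comm q p] at this
  have e : cupLabel (!c (rot p)) (!c (rot q)) (!c (rot r)) =
      !cupLabel (c (rot r)) (c (rot q)) (c (rot p)) := by
    generalize c (rot p) = x
    generalize c (rot q) = y
    generalize c (rot r) = z
    revert x y z
    decide
  simp only [e]
  split_ifs at this with h1 <;> simp [h1, this]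

lemma Concurrent.of_rot (h : Concurrent (S.image rot)) : Concurrent S := by
  obtain ⟨t, y, h⟩ := h
  refine ⟨t, -y, fun a ha => ?_⟩
  have := h _ (Finset.mem_image_of_mem _ ha)
  simp only [rot] at this
  linarith

lemma CupCapBounded.rot {a b : ℕ} (h : CupCapBounded l a b X) :
    CupCapBounded l b a (X.image rot) := by
  refine ⟨?_, ?_, ?_, ?_, ?_, ?_⟩
  · intro p hp q hq e
    obtain ⟨p, hp', rfl⟩ := Finset.mem_image.1 hp
    obtain ⟨q, hq', rfl⟩ := Finset.mem_image.1 hq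
    rw [h.inj p hp' q hq' (by simpa [LinesES.rot] using e)]
  all_goals
    intro S hS
    obtain ⟨T, hT, rfl⟩ := Finset.subset_image_iff.1 hS
    rw [Finset.card_image_of_injective _ rot_injective]
  · exact fun hc => h.conc T hT hc.of_rot
  · exact fun c hc hl => h.cap T hT _ hc.of_rot
      fun p hp => by simpa using hl _ (Finset.mem_image_of_mem _ hp)
  · exact fun c hc hl => h.cup T hT _ hc.of_rot
      fun p hp => by simpa using hl _ (Finset.mem_image_of_mem _ hp)
  · intro c hc
    rw [add_comm]
    exact h.cell T hT _ hc.of_rot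
  · intro c hc hs ht hf
    refine h.sep T hT _ hc.of_rot (fun p hp q hq hpq => ?_) ?_ ?_
    · have := hs _ (Finset.mem_image_of_mem _ hq) _ (Finset.mem_image_of_mem _ hp)
        (by simpa [LinesES.rot] using hpq)
      revert this
      generalize c (LinesES.rot p) = x
      generalize c (LinesES.rot q) = y
      revert x y
      decide
    · simpa using hf
    · simpa using ht

/-- `X` has no `l` concurrent lines, no triple of its dual points is a strict cup, and its cells
have at most `b` lines. -/
structure CapChain (l b : ℕ) (X : Finset NonverticalLine) : Prop where
  inj : SlopeInj X
  conc : ∀ S ⊆ X, Concurrent S → S.card < l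
  weak : ∀ p ∈ X, ∀ q ∈ X, ∀ r ∈ X, p.slope < q.slope → q.slope < r.slope →
    chord q r ≤ chord p q
  cell : ∀ S ⊆ X, ∀ c, ConvexLabelling S c → S.card ≤ b

lemma CapChain.move {b : ℕ} (h : CapChain l b X) (u v β : ℝ) :
    CapChain l b (X.image (move u v β)) := by
  have inj := move_injective u v β
  refine ⟨h.inj.move u v β, ?_, ?_, ?_⟩
  · intro S hS
    obtain ⟨T, hT, rfl⟩ := Finset.subset_image_iff.1 hS
    rw [Finset.card_image_of_injective _ inj]
    exact fun hc => h.conc T hT hc.of_move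
  · intro p hp q hq r hr
    obtain ⟨p, hp', rfl⟩ := Finset.mem_image.1 hp
    obtain ⟨q, hq', rfl⟩ := Finset.mem_image.1 hq
    obtain ⟨r, hr', rfl⟩ := Finset.mem_image.1 hr
    intro h1 h2
    simp only [LinesES.move, add_lt_add_iff_right] at h1 h2
    rw [chord_move _ _ _ h1.ne, chord_move _ _ _ h2.ne]
    linarith [h.weak p hp' q hq' r hr' h1 h2]
  · intro S hS
    obtain ⟨T, hT, rfl⟩ := Finset.subset_image_iff.1 hS
    rw [Finset.card_image_of_injective _ inj]
    exact fun c hc => h.cell T hT _ hc.of_move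

lemma CapChain.cupCapBounded {b : ℕ} (h : CapChain l b X) : CupCapBounded l 2 b X := by
  have key : ∀ S ⊆ X, ∀ c, ConvexLabelling S c → ∀ p ∈ S, ∀ q ∈ S, ∀ r ∈ S,
      p.slope < q.slope → q.slope < r.slope → cupLabel (c p) (c q) (c r) = false :=
    fun S hS c hc p hp q hq r hr hpq hqr => hc.of_gt hp hq hr hpq hqr
      (lt_of_le_of_ne (h.weak p (hS hp) q (hS hq) r (hS hr) hpq hqr)
        (hc.chord_ne hp hq hr hpq hqr).symm)
  have key' : ∀ S ⊆ X, ∀ c, ConvexLabelling S c → (∀ p ∈ S, c p = true) → S.card ≤ 2 := by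
    intro S hS c hc hall
    refine card_le_two_of_ordered (h.inj.mono hS) fun p hp q hq r hr hpq hqr => ?_
    have := key S hS c hc p hp q hq r hr hpq hqr
    rw [hall p hp, hall q hq, hall r hr] at this
    exact absurd this (by decide)
  refine ⟨h.inj, h.conc, key', fun S hS c hc _ => h.cell S hS c hc,
    fun S hS c hc => (h.cell S hS c hc).trans (by omega), ?_⟩
  intro S hS c hc hs ⟨u, hu, hcu⟩ _
  rw [← card_filter_label S c]
  have h1 : (S.filter (fun p => c p = true)).card ≤ 2 :=
    key' _ ((Finset.filter_subset _ _).trans hS) c (hc.mono (Finset.filter_subset _ _))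
      fun p hp => (Finset.mem_filter.1 hp).2
  have h2 : (S.filter (fun p => c p = false)).card ≤ 1 := by
    refine card_le_one_of_ordered ((h.inj.mono hS).mono (Finset.filter_subset _ _))
      fun p hp q hq hpq => ?_
    rw [Finset.mem_filter] at hp hq
    have hup : u.slope < p.slope := by
      rcases (h.inj.mono hS).lt_or_gt hu hp.1 (by rintro rfl; simp [hcu] at hp) with h | h
      · exact h
      · have := hs p hp.1 u hu h hp.2
        rw [hcu] at this
        exact absurd this (by decide)
    have := key S hS c hc u hu p hp.1 q hq.1 hup hpq
    rw [hcu, hp.2, hq.2] at this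
    exact absurd this (by decide)
  omega

/-- `n` lines through a common point. -/
noncomputable def pencil (n : ℕ) : Finset NonverticalLine :=
  (Finset.range n).image fun i : ℕ => ⟨i, 0⟩

lemma card_pencil (n : ℕ) : (pencil n).card = n := by
  rw [pencil, Finset.card_image_of_injective, Finset.card_range]
  intro i j h
  simpa using h

lemma chord_pencil {n : ℕ} {p q : NonverticalLine} (hp : p ∈ pencil n) (hq : q ∈ pencil n) :
    chord p q = 0 := by
  obtain ⟨i, _, rfl⟩ := Finset.mem_image.1 hp
  obtain ⟨j, _, rfl⟩ := Finset.mem_image.1 hq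
  simp [chord]

lemma slopeInj_pencil (n : ℕ) : SlopeInj (pencil n) := by
  intro p hp q hq e
  obtain ⟨i, _, rfl⟩ := Finset.mem_image.1 hp
  obtain ⟨j, _, rfl⟩ := Finset.mem_image.1 hq
  simp only at e
  rw [e]

/-- Three concurrent lines never bound a common cell, so prepending `l - 1` concurrent lines adds
only two lines to a cell. -/
lemma CapChain.union_pencil {b : ℕ} {lo : ℝ} (hl : 3 ≤ l) (h : CapChain l b R)
    (bR : ∀ p ∈ R, ∀ q ∈ R, p.slope < q.slope → chord p q < lo)
    (hx : ∀ p ∈ pencil (l - 1), ∀ q ∈ R, p.slope < q.slope ∧ lo < chord p q ∧ chord p q < 0) :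
    CapChain l (b + 2) (pencil (l - 1) ∪ R) := by
  have hlt : ∀ p ∈ pencil (l - 1), ∀ q ∈ R, p.slope < q.slope :=
    fun p hp q hq => (hx p hp q hq).1
  refine ⟨(slopeInj_pencil _).union h.inj hlt,
    concurrent_union (slopeInj_pencil _) h.inj hlt hl ?_ h.conc ?_ ?_, ?_, ?_⟩
  · intro S hS _
    have := Finset.card_le_card hS
    rw [card_pencil] at this
    omega
  · intro p hp q hq r hr _
    rw [chord_pencil hp hq]
    exact (hx q hq r hr).2.2.ne'
  · intro p hp q hq r hr hqr
    exact ((bR q hq r hr hqr).trans (hx p hp q hq).2.1).ne'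
  · intro p hp q hq r hr hpq hqr
    rcases Finset.mem_union.1 hp with hp | hp <;> rcases Finset.mem_union.1 hq with hq | hq <;>
      rcases Finset.mem_union.1 hr with hr | hr
    · rw [chord_pencil hp hq, chord_pencil hq hr]
    · rw [chord_pencil hp hq]
      exact (hx q hq r hr).2.2.le
    · exact absurd hqr (hlt r hr q hq).not_gt
    · exact ((bR q hq r hr hqr).trans (hx p hp q hq).2.1).le
    · exact absurd hpq (hlt q hq p hp).not_gt
    · exact absurd hpq (hlt q hq p hp).not_gt
    · exact absurd hqr (hlt r hr q hq).not_gt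
    · exact h.weak p hp q hq r hr hpq hqr
  · intro S hS c hc
    obtain ⟨A, B, sL, sR, rfl, hsum⟩ := exists_split (disjoint_of_slope_lt hlt) hS
    have h1 := h.cell B sR c (hc.mono Finset.subset_union_right)
    have h2 : A.card ≤ 2 := by
      refine card_le_two_of_ordered ((slopeInj_pencil _).mono sL)
        fun p hp q hq r hr hpq hqr => ?_
      refine (hc.mono Finset.subset_union_left).chord_ne hp hq hr hpq hqr ?_
      rw [chord_pencil (sL hp) (sL hq), chord_pencil (sL hq) (sL hr)]
    omega

lemma exists_capChain (hl : 3 ≤ l) (b : ℕ) :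
    ∃ X, CapChain l b X ∧ (l - 1) * b ≤ 2 * X.card + (l - 3) := by
  induction b using Nat.twoStepInduction with
  | zero =>
    refine ⟨∅, ⟨by simp [SlopeInj], ?_, by simp, ?_⟩, by simp⟩
    · intro S hS _
      rw [Finset.subset_empty.1 hS, Finset.card_empty]
      omega
    · intro S hS c _
      rw [Finset.subset_empty.1 hS, Finset.card_empty]
  | one =>
    refine ⟨{⟨0, 0⟩}, ⟨?_, ?_, ?_, ?_⟩, by simp; omega⟩
    · intro p hp q hq _
      rw [Finset.mem_singleton.1 hp, Finset.mem_singleton.1 hq]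
    · intro S hS _
      have := Finset.card_le_card hS
      rw [Finset.card_singleton] at this
      omega
    · intro p hp q hq r hr hpq
      rw [Finset.mem_singleton.1 hp, Finset.mem_singleton.1 hq] at hpq
      exact absurd hpq (lt_irrefl _)
    · intro S hS c _
      simpa using Finset.card_le_card hS
  | more b ih _ =>
    obtain ⟨X, hX, hcard⟩ := ih
    obtain ⟨M, -, hM⟩ := exists_chord_bound X
    -- chords are `0` in the pencil, below `-2` in the sheared copy of `X`, and near `-1` across
    obtain ⟨u, v, hx⟩ := exists_move (pencil (l - 1)) (X.image (move 0 0 (-2 - M)))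
      (lo := -2) (μ := -1) (hi := 0) (by norm_num) (by norm_num)
    have hX' := (hX.move 0 0 (-2 - M)).move u v 0
    refine ⟨_, hX'.union_pencil (lo := -2) hl ?_ hx, ?_⟩
    · intro p hp q hq hpq
      obtain ⟨p', hp', rfl⟩ := Finset.mem_image.1 hp
      obtain ⟨q', hq', rfl⟩ := Finset.mem_image.1 hq
      obtain ⟨p, hp'', rfl⟩ := Finset.mem_image.1 hp'
      obtain ⟨q, hq'', rfl⟩ := Finset.mem_image.1 hq'
      simp only [LinesES.move, add_lt_add_iff_right] at hpq
      rw [chord_translate, chord_move _ _ _ hpq.ne]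
      linarith [(abs_lt.1 (hM p hp'' q hq'')).2]
    · rw [Finset.card_union_of_disjoint (disjoint_of_slope_lt fun p hp q hq => (hx p hp q hq).1),
        Finset.card_image_of_injective _ (move_injective _ _ _),
        Finset.card_image_of_injective _ (move_injective _ _ _), card_pencil]
      rw [mul_add]
      omega

/-- The Erdős–Szekeres recursion started at `a = 2` or `b = 2` from chains of collinear groups of
`l - 1` dual points. A cap of `b` points has `b / 2` pairs, each of which such a group replaces; the
term with the factor `l - 3` accounts for the point left over when `b` is odd. -/
lemma exists_cupCapBounded (hl : 3 ≤ l) (i j : ℕ) :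
    ∃ X, CupCapBounded l (i + 2) (j + 2) X ∧
      (l - 1) * (i + j + 2).choose (i + 1) ≤ 2 * X.card + (l - 3) * (i + j).choose i := by
  induction i generalizing j with
  | zero =>
    obtain ⟨X, hX, hc⟩ := exists_capChain hl (j + 2)
    exact ⟨X, hX.cupCapBounded, by simpa using hc⟩
  | succ i ihi =>
    induction j with
    | zero =>
      obtain ⟨X, hX, hc⟩ := exists_capChain hl (i + 1 + 2)
      refine ⟨_, hX.cupCapBounded.rot, ?_⟩
      rw [Finset.card_image_of_injective _ rot_injective]
      have : (i + 1 + 0 + 2).choose (i + 1 + 1) = i + 1 + 2 := by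
        simp
      rw [this]
      simpa using hc
    | succ j ihj =>
      obtain ⟨L, hL, cL⟩ := ihi (j + 1)
      obtain ⟨R, hR, cR⟩ := ihj
      obtain ⟨M, -, hM⟩ := exists_chord_bound L
      obtain ⟨M', -, hM'⟩ := exists_chord_bound R
      obtain ⟨u, v, hx⟩ := exists_move L R (lo := max M M') (lt_add_one _) (lt_add_one _)
      refine ⟨L ∪ R.image (move u v 0), ?_, ?_⟩
      · refine CupCapBounded.union hl (by omega) (by omega) hL (hR.move u v 0)
          (fun p hp q hq => ?_) (fun p hp q hq => ?_)
          fun p hp q hq => ⟨(hx p hp q hq).1, (hx p hp q hq).2.1⟩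
        · exact (abs_lt.1 (hM p hp q hq)).2.trans_le (le_max_left _ _)
        · obtain ⟨p, hp', rfl⟩ := Finset.mem_image.1 hp
          obtain ⟨q, hq', rfl⟩ := Finset.mem_image.1 hq
          rw [chord_translate]
          exact (abs_lt.1 (hM' p hp' q hq')).2.trans_le (le_max_right _ _)
      · rw [Finset.card_union_of_disjoint
          (disjoint_of_slope_lt fun p hp q hq => (hx p hp q hq).1),
          Finset.card_image_of_injective _ (move_injective _ _ _)]
        have e1 : (i + 1 + (j + 1) + 2).choose (i + 1 + 1) =
            (i + (j + 1) + 2).choose (i + 1) + (i + 1 + j + 2).choose (i + 1 + 1) := by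
          rw [show i + 1 + (j + 1) + 2 = (i + (j + 1) + 2) + 1 by ring, Nat.choose_succ_succ,
            show i + 1 + j + 2 = i + (j + 1) + 2 by ring]
        have e2 : (i + 1 + (j + 1)).choose (i + 1) =
            (i + (j + 1)).choose i + (i + 1 + j).choose (i + 1) := by
          rw [show i + 1 + (j + 1) = (i + (j + 1)) + 1 by ring, Nat.choose_succ_succ,
            show i + 1 + j = i + (j + 1) by ring]
        rw [e1, e2, mul_add, mul_add, mul_add]
        omega

/-! ### Sets divided into bundles -/

/-- All chords of `S` are negative. -/
def IsBundle (S : Finset NonverticalLine) : Prop :=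
  ∀ p ∈ S, ∀ q ∈ S, p.slope < q.slope → chord p q < 0

/-- In a bundle no line below the cell precedes a line above it, and of two lines of different
bundles the first is below and the second is above the cell; so at most two bundles occur. -/
def SteepLabelling (S : Finset NonverticalLine) (c : NonverticalLine → Bool) : Prop :=
  ∀ p ∈ S, ∀ q ∈ S, p.slope < q.slope →
    (chord p q < 0 ∧ (c p = false → c q = false)) ∨ (0 < chord p q ∧ c p = false ∧ c q = true)

/-- A bundle contributes at most two lines to the cell: one above and, to its right in the dual
plane, one below. -/
def ThinLabelling (S : Finset NonverticalLine) (c : NonverticalLine → Bool) : Prop :=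
  ∀ p ∈ S, ∀ q ∈ S, p.slope < q.slope →
    (chord p q < 0 ∧ c p = true ∧ c q = false) ∨ 0 < chord p q

/-- `X` is divided into bundles: chords are negative inside a bundle and positive between bundles.
Bundles have cups of at most `m` and caps of at most `n'` points, and caps of at most `n` points
except in the last bundle. The numbers `a`, `b` bound cups and caps with at most one point in each
bundle, and more generally the cells with a thin labelling; `N` bounds all cells. -/
structure Bundled (l a b m n n' N : ℕ) (X : Finset NonverticalLine) : Prop where
  inj : SlopeInj X
  conc : ∀ S ⊆ X, Concurrent S → S.card < l
  ne_zero : ∀ p ∈ X, ∀ q ∈ X, p.slope < q.slope → chord p q ≠ 0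
  trans : ∀ p ∈ X, ∀ q ∈ X, ∀ r ∈ X, p ≠ r → chord p q < 0 → chord q r < 0 → chord p r < 0
  cup : ∀ S ⊆ X, ∀ c, ConvexLabelling S c → IsBundle S → (∀ p ∈ S, c p = true) → S.card ≤ m
  cap : ∀ S ⊆ X, ∀ c, ConvexLabelling S c → IsBundle S → (∀ p ∈ S, c p = false) → S.card ≤ n'
  cap_of_right : ∀ S ⊆ X, ∀ c, ConvexLabelling S c → IsBundle S → (∀ p ∈ S, c p = false) →
    (∃ z ∈ X, ∀ p ∈ S, p.slope < z.slope ∧ 0 < chord p z) → S.card ≤ n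
  sep : ∀ S ⊆ X, ∀ c, ConvexLabelling S c → IsBundle S →
    (∀ p ∈ S, ∀ q ∈ S, p.slope < q.slope → c p = false → c q = false) →
    (∃ p ∈ S, c p = true) → (∃ p ∈ S, c p = false) → S.card ≤ 3
  thin_cup : ∀ S ⊆ X, ∀ c, ConvexLabelling S c → ThinLabelling S c → (∀ p ∈ S, c p = true) →
    S.card ≤ a
  thin_cap : ∀ S ⊆ X, ∀ c, ConvexLabelling S c → ThinLabelling S c → (∀ p ∈ S, c p = false) →
    S.card ≤ b
  thin : ∀ S ⊆ X, ∀ c, ConvexLabelling S c → ThinLabelling S c → S.card ≤ a + b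
  cell : ∀ S ⊆ X, ∀ c, ConvexLabelling S c → S.card ≤ N

/-- A shear turns a set into a single bundle. -/
lemma CupCapBounded.exists_bundled (h : CupCapBounded l m n' X) (ha : 1 ≤ a) (hb : 1 ≤ b)
    (hN : m + n' ≤ N) : ∃ Y, Y.card = X.card ∧ Bundled l a b m n n' N Y := by
  obtain ⟨M, hM0, hM⟩ := exists_chord_bound X
  have hY := h.move 0 0 (-M)
  have neg : IsBundle (X.image (LinesES.move 0 0 (-M))) := by
    intro p hp q hq hpq
    obtain ⟨p, hp', rfl⟩ := Finset.mem_image.1 hp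
    obtain ⟨q, hq', rfl⟩ := Finset.mem_image.1 hq
    rw [chord_move _ _ _ (by simpa [LinesES.move] using hpq.ne)]
    linarith [(abs_lt.1 (hM p hp' q hq')).2]
  refine ⟨_, Finset.card_image_of_injective _ (move_injective 0 0 (-M)), ?_⟩
  generalize X.image (LinesES.move 0 0 (-M)) = Y at hY neg
  have neg' : ∀ p ∈ Y, ∀ q ∈ Y, p ≠ q → chord p q < 0 := by
    intro p hp q hq hne
    rcases hY.inj.lt_or_gt hp hq hne with h | h
    · exact neg p hp q hq h
    · rw [chord_comm]
      exact neg q hq p hp h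
  have thin : ∀ S ⊆ Y, ∀ c, ThinLabelling S c → ∀ p ∈ S, ∀ q ∈ S, p.slope < q.slope →
      c p = true ∧ c q = false := by
    intro S hS c ht p hp q hq hpq
    rcases ht p hp q hq hpq with h | h
    · exact h.2
    · exact absurd h (neg p (hS hp) q (hS hq) hpq).not_gt
  refine ⟨hY.inj, hY.conc, fun p hp q hq hpq => (neg p hp q hq hpq).ne,
    fun p hp q hq r hr hne _ _ => neg' p hp r hr hne,
    fun S hS c hc _ => hY.cup S hS c hc, fun S hS c hc _ => hY.cap S hS c hc, ?_,
    fun S hS c hc _ => hY.sep S hS c hc, ?_, ?_, ?_,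
    fun S hS c hc => (hY.cell S hS c hc).trans hN⟩
  · intro S hS c hc _ _ ⟨z, hz, h⟩
    rcases S.eq_empty_or_nonempty with rfl | ⟨p, hp⟩
    · simp
    · exact absurd (h p hp).2 (neg p (hS hp) z hz (h p hp).1).not_gt
  · intro S hS c hc ht hall
    refine (card_le_one_of_ordered (hY.inj.mono hS) fun p hp q hq hpq => ?_).trans ha
    have := (thin S hS c ht p hp q hq hpq).2
    rw [hall q hq] at this
    exact absurd this (by decide)
  · intro S hS c hc ht hall
    refine (card_le_one_of_ordered (hY.inj.mono hS) fun p hp q hq hpq => ?_).trans hb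
    have := (thin S hS c ht p hp q hq hpq).1
    rw [hall p hp] at this
    exact absurd this (by decide)
  · intro S hS c hc ht
    refine (card_le_two_of_labels (c := c) (hY.inj.mono hS) (thin S hS c ht)).trans (by omega)

lemma IsBundle.mono (h : IsBundle S) (hT : T ⊆ S) : IsBundle T :=
  fun p hp q hq => h p (hT hp) q (hT hq)

lemma ThinLabelling.mono (h : ThinLabelling S c) (hT : T ⊆ S) : ThinLabelling T c :=
  fun p hp q hq => h p (hT hp) q (hT hq)

lemma SteepLabelling.isBundle (h : SteepLabelling S c) (u : Bool) (hu : ∀ p ∈ S, c p = u) :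
    IsBundle S := by
  intro p hp q hq hpq
  rcases h p hp q hq hpq with h | h
  · exact h.1
  · rw [hu p hp, hu q hq] at h
    exact absurd (h.2.1.symm.trans h.2.2) (by decide)

lemma SteepLabelling.label_ne (h : SteepLabelling S c) (ht : ThinLabelling S c) :
    ∀ p ∈ S, ∀ q ∈ S, p.slope < q.slope → c p ≠ c q := by
  intro p hp q hq hpq
  rcases h p hp q hq hpq with h | h <;> rcases ht p hp q hq hpq with h' | h'
  · rw [h'.2.1, h'.2.2]; decide
  · exact absurd h' h.1.not_gt
  · exact absurd h.1 h'.1.not_gt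
  · rw [h.2.1, h.2.2]; decide

lemma SteepLabelling.card_le_two (h : SteepLabelling S c) (ht : ThinLabelling S c)
    (hS : SlopeInj S) : S.card ≤ 2 :=
  card_le_two_of_labels_ne hS (h.label_ne ht)

lemma SteepLabelling.card_le_one (h : SteepLabelling S c) (ht : ThinLabelling S c)
    (hS : SlopeInj S) (u : Bool) (hu : ∀ p ∈ S, c p = u) : S.card ≤ 1 :=
  card_le_one_of_ordered hS fun p hp q hq hpq =>
    h.label_ne ht p hp q hq hpq ((hu p hp).trans (hu q hq).symm)

/-- In a steep labelling with both labels, either all lines belong to one bundle, or the lines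
below the cell form one bundle and the lines above it a later one. -/
lemma Bundled.card_le_of_steepLabelling (h : Bundled l a b m n n' N X) (hS : S ⊆ X)
    (hc : ConvexLabelling S c) (hs : SteepLabelling S c) (ht : ∃ p ∈ S, c p = true)
    (hf : ∃ p ∈ S, c p = false) : S.card ≤ 3 ∨ S.card ≤ m + n := by
  have hinj := h.inj.mono hS
  by_cases hneg : ∃ p ∈ S, ∃ q ∈ S, chord p q < 0 ∧ c p = true ∧ c q = false
  · left
    obtain ⟨u, hu, d, hd, hud, hcu, hcd⟩ := hneg
    have same : ∀ p ∈ S, ∀ q ∈ S, p ≠ q → c p = c q → chord p q < 0 := by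
      intro p hp q hq hne hcpq
      rcases hinj.lt_or_gt hp hq hne with hlt | hlt
      · rcases hs p hp q hq hlt with h | h
        · exact h.1
        · rw [h.2.1, h.2.2] at hcpq
          exact absurd hcpq (by decide)
      · rw [chord_comm]
        rcases hs q hq p hp hlt with h | h
        · exact h.1
        · rw [h.2.1, h.2.2] at hcpq
          exact absurd hcpq (by decide)
    have toU : ∀ p ∈ S, p ≠ u → chord p u < 0 := by
      intro p hp hpu
      cases hcp : c p with
      | true => exact same p hp u hu hpu (hcp.trans hcu.symm)
      | false =>
        by_cases hpd : p = d
        · rw [hpd, chord_comm]; exact hud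
        · refine h.trans p (hS hp) d (hS hd) u (hS hu) hpu
            (same p hp d hd hpd (hcp.trans hcd.symm)) ?_
          rw [chord_comm]; exact hud
    have hb : IsBundle S := by
      intro p hp q hq hpq
      have hne : p ≠ q := by rintro rfl; exact lt_irrefl _ hpq
      by_cases hpu : p = u
      · rw [hpu, chord_comm]
        exact toU q hq (hpu ▸ hne.symm)
      by_cases hqu : q = u
      · rw [hqu]
        exact toU p hp hpu
      · refine h.trans p (hS hp) u (hS hu) q (hS hq) hne (toU p hp hpu) ?_
        rw [chord_comm]
        exact toU q hq hqu
    refine h.sep S hS c hc hb (fun p hp q hq hpq => ?_) ht hf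
    rcases hs p hp q hq hpq with h | h
    · exact h.2
    · exact absurd h.1 (hb p hp q hq hpq).not_gt
  · right
    push Not at hneg
    rw [← card_filter_label S c]
    have st : S.filter (fun p => c p = true) ⊆ S := Finset.filter_subset _ _
    have sf : S.filter (fun p => c p = false) ⊆ S := Finset.filter_subset _ _
    have allt : ∀ p ∈ S.filter (fun p => c p = true), c p = true :=
      fun p hp => (Finset.mem_filter.1 hp).2
    have allf : ∀ p ∈ S.filter (fun p => c p = false), c p = false :=
      fun p hp => (Finset.mem_filter.1 hp).2
    refine add_le_add (h.cup _ (st.trans hS) c (hc.mono st) ?_ allt)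
      (h.cap_of_right _ (sf.trans hS) c (hc.mono sf) ?_ allf ?_)
    · exact SteepLabelling.isBundle (c := c) (fun p hp q hq => hs p (st hp) q (st hq)) _ allt
    · exact SteepLabelling.isBundle (c := c) (fun p hp q hq => hs p (sf hp) q (sf hq)) _ allf
    · obtain ⟨z, hz, hcz⟩ := ht
      refine ⟨z, hS hz, fun p hp => ?_⟩
      have hcp := allf p hp
      have hnot := hneg z hz p (sf hp)
      have hpz : p ≠ z := by rintro rfl; rw [hcz] at hcp; exact absurd hcp (by decide)
      rcases hinj.lt_or_gt (sf hp) hz hpz with hlt | hlt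
      · rcases hs p (sf hp) z hz hlt with h | h
        · exact absurd hcp (hnot (by rw [chord_comm]; exact h.1) hcz)
        · exact ⟨hlt, h.1⟩
      · rcases hs z hz p (sf hp) hlt with h | h
        · exact absurd hcp (hnot h.1 hcz)
        · rw [hcz] at h
          exact absurd h.2.1 (by decide)

lemma IsBundle.subset_or_subset (hS : S ⊆ L ∪ R) (h : IsBundle S)
    (hx : ∀ p ∈ L, ∀ q ∈ R, p.slope < q.slope ∧ 0 < chord p q) : S ⊆ L ∨ S ⊆ R := by
  by_contra! hcon
  obtain ⟨h1, h2⟩ := hcon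
  obtain ⟨p, hp, hpL⟩ := Finset.not_subset.1 h1
  obtain ⟨q, hq, hqR⟩ := Finset.not_subset.1 h2
  have hpR := (Finset.mem_union.1 (hS hp)).resolve_left hpL
  have hqL := (Finset.mem_union.1 (hS hq)).resolve_right hqR
  exact (h q hq p hp (hx q hqL p hpR).1).not_gt (hx q hqL p hpR).2

/-- What the lines of a cell on one side of the decomposition `A ∪ B` force on the labels on the
other side, when the chords between `A` and `B` lie between the negative chords inside the bundles
and the positive chords between bundles of the same side. -/
structure CrossSteep (A B : Finset NonverticalLine) (c : NonverticalLine → Bool) : Prop where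
  left_true : (∃ r ∈ B, c r = true) → SteepLabelling A c
  left_false : (∃ r ∈ B, c r = false) → ThinLabelling A c
  right_true : (∃ p ∈ A, c p = true) → ThinLabelling B c
  right_false : (∃ p ∈ A, c p = false) → SteepLabelling B c

lemma crossSteep {hi : ℝ}
    (zL : ∀ p ∈ L, ∀ q ∈ L, p.slope < q.slope → chord p q ≠ 0)
    (zR : ∀ p ∈ R, ∀ q ∈ R, p.slope < q.slope → chord p q ≠ 0)
    (bL : ∀ p ∈ L, ∀ q ∈ L, 0 < chord p q → hi < chord p q)
    (bR : ∀ p ∈ R, ∀ q ∈ R, 0 < chord p q → hi < chord p q)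
    (hx : ∀ p ∈ L, ∀ q ∈ R, p.slope < q.slope ∧ 0 < chord p q ∧ chord p q < hi)
    (sL : A ⊆ L) (sR : B ⊆ R) (hc : ConvexLabelling (A ∪ B) c) : CrossSteep A B c := by
  have mA : ∀ {p}, p ∈ A → p ∈ A ∪ B := fun h => Finset.mem_union_left _ h
  have mB : ∀ {p}, p ∈ B → p ∈ A ∪ B := fun h => Finset.mem_union_right _ h
  have hLLR : ∀ p ∈ A, ∀ q ∈ A, ∀ r ∈ B, p.slope < q.slope →
      (chord p q < 0 ∧ cupLabel (c p) (c q) (c r) = true) ∨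
      (0 < chord p q ∧ cupLabel (c p) (c q) (c r) = false) := by
    intro p hp q hq r hr hpq
    obtain ⟨x1, x2, x3⟩ := hx q (sL hq) r (sR hr)
    rcases (zL p (sL hp) q (sL hq) hpq).lt_or_gt with h | h
    · exact Or.inl ⟨h, hc.of_lt (mA hp) (mA hq) (mB hr) hpq x1 (h.trans x2)⟩
    · exact Or.inr ⟨h, hc.of_gt (mA hp) (mA hq) (mB hr) hpq x1
        (x3.trans (bL p (sL hp) q (sL hq) h))⟩
  have hLRR : ∀ p ∈ A, ∀ q ∈ B, ∀ r ∈ B, q.slope < r.slope →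
      (chord q r < 0 ∧ cupLabel (c p) (c q) (c r) = false) ∨
      (0 < chord q r ∧ cupLabel (c p) (c q) (c r) = true) := by
    intro p hp q hq r hr hqr
    obtain ⟨x1, x2, x3⟩ := hx p (sL hp) q (sR hq)
    rcases (zR q (sR hq) r (sR hr) hqr).lt_or_gt with h | h
    · exact Or.inl ⟨h, hc.of_gt (mA hp) (mB hq) (mB hr) x1 hqr (h.trans x2)⟩
    · exact Or.inr ⟨h, hc.of_lt (mA hp) (mB hq) (mB hr) x1 hqr
        (x3.trans (bR q (sR hq) r (sR hr) h))⟩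
  refine ⟨?_, ?_, ?_, ?_⟩
  · rintro ⟨r, hr, hcr⟩ p hp q hq hpq
    have := hLLR p hp q hq r hr hpq
    rw [hcr] at this
    refine this.imp (And.imp_right ?_) (And.imp_right ?_) <;>
      (generalize c p = x; generalize c q = y; revert x y; decide)
  · rintro ⟨r, hr, hcr⟩ p hp q hq hpq
    have := hLLR p hp q hq r hr hpq
    rw [hcr] at this
    refine this.imp (And.imp_right ?_) And.left
    generalize c p = x; generalize c q = y; revert x y; decide
  · rintro ⟨r, hr, hcr⟩ p hp q hq hpq
    have := hLRR r hr p hp q hq hpq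
    rw [hcr] at this
    refine this.imp (And.imp_right ?_) And.left
    generalize c p = x; generalize c q = y; revert x y; decide
  · rintro ⟨r, hr, hcr⟩ p hp q hq hpq
    have := hLRR r hr p hp q hq hpq
    rw [hcr] at this
    refine this.imp (And.imp_right ?_) (And.imp_right ?_) <;>
      (generalize c p = x; generalize c q = y; revert x y; decide)

/-- The step of the construction: the chords between `L` and `R` are positive, but smaller than
all other positive chords. Then the bundles of `L` and `R` are those of `L ∪ R`, and only the last
bundle of `R` may have caps with more than `n` points. -/
lemma Bundled.union {hi : ℝ} (hl : 3 ≤ l) (ha : 1 ≤ a) (hb : 1 ≤ b) (hn : n ≤ n')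
    (hN1 : m + n + 1 ≤ N) (hN2 : a + 1 + (b + 1) ≤ N) (hN3 : n' + b ≤ N)
    (hN4 : m + a ≤ N)
    (hL : Bundled l (a + 1) b m n n N L) (hR : Bundled l a (b + 1) m n n' N R)
    (bL : ∀ p ∈ L, ∀ q ∈ L, 0 < chord p q → hi < chord p q)
    (bR : ∀ p ∈ R, ∀ q ∈ R, 0 < chord p q → hi < chord p q)
    (hx : ∀ p ∈ L, ∀ q ∈ R, p.slope < q.slope ∧ 0 < chord p q ∧ chord p q < hi) :
    Bundled l (a + 1) (b + 1) m n n' N (L ∪ R) := by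
  have hlt : ∀ p ∈ L, ∀ q ∈ R, p.slope < q.slope := fun p hp q hq => (hx p hp q hq).1
  have hpos : ∀ p ∈ L, ∀ q ∈ R, p.slope < q.slope ∧ 0 < chord p q :=
    fun p hp q hq => ⟨(hx p hp q hq).1, (hx p hp q hq).2.1⟩
  have hinj := hL.inj.union hR.inj hlt
  have hdis := disjoint_of_slope_lt hlt
  have cross : ∀ A B c, A ⊆ L → B ⊆ R → ConvexLabelling (A ∪ B) c → CrossSteep A B c :=
    fun A B c => crossSteep hL.ne_zero hR.ne_zero bL bR hx
  have hcup : ∀ S ⊆ L ∪ R, ∀ c, ConvexLabelling S c → ThinLabelling S c →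
      (∀ p ∈ S, c p = true) → S.card ≤ a + 1 := by
    intro S hS c hc ht hall
    obtain ⟨A, B, sL, sR, rfl, hsum⟩ := exists_split hdis hS
    have X := cross A B c sL sR hc
    have hA := Finset.forall_mem_union.1 hall
    have tA := ht.mono (Finset.subset_union_left (s₁ := A) (s₂ := B))
    have tB := ht.mono (Finset.subset_union_right (s₁ := A) (s₂ := B))
    have nR := hR.thin_cup B sR c (hc.mono Finset.subset_union_right) tB hA.2
    rcases B.eq_empty_or_nonempty with rfl | ⟨r, hr⟩
    · have nL := hL.thin_cup A sL c (hc.mono Finset.subset_union_left) tA hA.1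
      simpa using nL
    · have := (X.left_true ⟨r, hr, hA.2 r hr⟩).card_le_one tA (hL.inj.mono sL) _ hA.1
      omega
  have hcap : ∀ S ⊆ L ∪ R, ∀ c, ConvexLabelling S c → ThinLabelling S c →
      (∀ p ∈ S, c p = false) → S.card ≤ b + 1 := by
    intro S hS c hc ht hall
    obtain ⟨A, B, sL, sR, rfl, hsum⟩ := exists_split hdis hS
    have X := cross A B c sL sR hc
    have hA := Finset.forall_mem_union.1 hall
    have tA := ht.mono (Finset.subset_union_left (s₁ := A) (s₂ := B))
    have tB := ht.mono (Finset.subset_union_right (s₁ := A) (s₂ := B))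
    have nL := hL.thin_cap A sL c (hc.mono Finset.subset_union_left) tA hA.1
    rcases A.eq_empty_or_nonempty with rfl | ⟨p, hp⟩
    · have nR := hR.thin_cap B sR c (hc.mono Finset.subset_union_right) tB hA.2
      simpa using nR
    · have := (X.right_false ⟨p, hp, hA.1 p hp⟩).card_le_one tB (hR.inj.mono sR) _ hA.2
      omega
  have hthin : ∀ S ⊆ L ∪ R, ∀ c, ConvexLabelling S c → ThinLabelling S c →
      S.card ≤ a + 1 + (b + 1) := by
    intro S hS c hc ht
    obtain ⟨A, B, sL, sR, rfl, hsum⟩ := exists_split hdis hS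
    have X := cross A B c sL sR hc
    have tA := ht.mono (Finset.subset_union_left (s₁ := A) (s₂ := B))
    have tB := ht.mono (Finset.subset_union_right (s₁ := A) (s₂ := B))
    have cA : ConvexLabelling A c := hc.mono Finset.subset_union_left
    have cB : ConvexLabelling B c := hc.mono Finset.subset_union_right
    have iA := hL.inj.mono sL
    have iB := hR.inj.mono sR
    have nA := hL.thin A sL c cA tA
    have nB := hR.thin B sR c cB tB
    by_cases hBt : ∃ r ∈ B, c r = true
    · have stA := X.left_true hBt
      by_cases hAf : ∃ p ∈ A, c p = false
      · have := stA.card_le_two tA iA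
        have := (X.right_false hAf).card_le_two tB iB
        omega
      · push Not at hAf
        have := stA.card_le_one tA iA true fun p hp => Bool.eq_true_of_not_eq_false (hAf p hp)
        omega
    · push Not at hBt
      have hBf : ∀ r ∈ B, c r = false := fun p hp => Bool.eq_false_of_not_eq_true (hBt p hp)
      by_cases hAf : ∃ p ∈ A, c p = false
      · have := (X.right_false hAf).card_le_one tB iB _ hBf
        omega
      · push Not at hAf
        have := hL.thin_cup A sL c cA tA fun p hp => Bool.eq_true_of_not_eq_false (hAf p hp)
        have := hR.thin_cap B sR c cB tB hBf
        omega
  refine ⟨hinj, concurrent_union hL.inj hR.inj hlt hl hL.conc hR.conc ?_ ?_, ?_, ?_, ?_, ?_, ?_,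
    ?_, hcup, hcap, hthin, ?_⟩
  · intro p hp q hq r hr hpq
    obtain ⟨x1, x2, x3⟩ := hx q hq r hr
    rcases (hL.ne_zero p hp q hq hpq).lt_or_gt with h | h
    · exact (h.trans x2).ne
    · exact (x3.trans (bL p hp q hq h)).ne'
  · intro p hp q hq r hr hqr
    obtain ⟨x1, x2, x3⟩ := hx p hp q hq
    rcases (hR.ne_zero q hq r hr hqr).lt_or_gt with h | h
    · exact (h.trans x2).ne'
    · exact (x3.trans (bR q hq r hr h)).ne
  · intro p hp q hq hpq
    rcases Finset.mem_union.1 hp with hp | hp <;> rcases Finset.mem_union.1 hq with hq | hq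
    · exact hL.ne_zero p hp q hq hpq
    · exact (hpos p hp q hq).2.ne'
    · exact absurd hpq (hlt q hq p hp).not_gt
    · exact hR.ne_zero p hp q hq hpq
  · intro p hp q hq r hr hne h1 h2
    rcases Finset.mem_union.1 hp with hp | hp <;> rcases Finset.mem_union.1 hq with hq | hq <;>
      rcases Finset.mem_union.1 hr with hr | hr
    · exact hL.trans p hp q hq r hr hne h1 h2
    · exact absurd h2 (hpos q hq r hr).2.not_gt
    · exact absurd h1 (hpos p hp q hq).2.not_gt
    · exact absurd h1 (hpos p hp q hq).2.not_gt
    · rw [chord_comm] at h1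
      exact absurd h1 (hpos q hq p hp).2.not_gt
    · rw [chord_comm] at h1
      exact absurd h1 (hpos q hq p hp).2.not_gt
    · rw [chord_comm] at h2
      exact absurd h2 (hpos r hr q hq).2.not_gt
    · exact hR.trans p hp q hq r hr hne h1 h2
  · intro S hS c hc hb hall
    rcases hb.subset_or_subset hS hpos with h | h
    · exact hL.cup S h c hc hb hall
    · exact hR.cup S h c hc hb hall
  · intro S hS c hc hb hall
    rcases hb.subset_or_subset hS hpos with h | h
    · exact (hL.cap S h c hc hb hall).trans hn
    · exact hR.cap S h c hc hb hall
  · intro S hS c hc hb hall ⟨z, hz, hSz⟩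
    rcases hb.subset_or_subset hS hpos with h | h
    · exact hL.cap S h c hc hb hall
    · rcases S.eq_empty_or_nonempty with rfl | ⟨p, hp⟩
      · simp
      · refine hR.cap_of_right S h c hc hb hall ⟨z, ?_, hSz⟩
        refine (Finset.mem_union.1 hz).resolve_left fun hz' => ?_
        exact lt_asymm (hSz p hp).1 (hlt z hz' p (h hp))
  · intro S hS c hc hb
    rcases hb.subset_or_subset hS hpos with h | h
    · exact hL.sep S h c hc hb
    · exact hR.sep S h c hc hb
  · intro S hS c hc
    have hthinS := hthin S hS c hc
    obtain ⟨A, B, sL, sR, rfl, hsum⟩ := exists_split hdis hS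
    have X := cross A B c sL sR hc
    have cA : ConvexLabelling A c := hc.mono Finset.subset_union_left
    have cB : ConvexLabelling B c := hc.mono Finset.subset_union_right
    have iA := hL.inj.mono sL
    have iB := hR.inj.mono sR
    have nA := hL.cell A sL c cA
    have nB := hR.cell B sR c cB
    have thinUnion : ThinLabelling A c → ThinLabelling B c →
        (A ∪ B).card ≤ a + 1 + (b + 1) := by
      intro tA tB
      refine hthinS fun p hp q hq hpq => ?_
      rcases Finset.mem_union.1 hp with hp | hp <;> rcases Finset.mem_union.1 hq with hq | hq
      · exact tA p hp q hq hpq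
      · exact Or.inr (hpos p (sL hp) q (sR hq)).2
      · exact absurd hpq (hlt q (sL hq) p (sR hp)).not_gt
      · exact tB p hp q hq hpq
    have thinOfCard : ∀ {Y}, Y.card ≤ 1 → ThinLabelling Y c := by
      intro Y hY p hp q hq hpq
      rw [Finset.card_le_one.1 hY p hp q hq] at hpq
      exact absurd hpq (lt_irrefl _)
    have split : ∀ Y : Finset NonverticalLine, (∃ p ∈ Y, c p = true) ∧ (∃ p ∈ Y, c p = false) ∨
        (∀ p ∈ Y, c p = true) ∨ ((∀ p ∈ Y, c p = false) ∧ Y.Nonempty) := by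
      intro Y
      by_cases h1 : ∃ p ∈ Y, c p = true
      · by_cases h2 : ∃ p ∈ Y, c p = false
        · exact Or.inl ⟨h1, h2⟩
        · push Not at h2
          exact Or.inr (Or.inl fun p hp => Bool.eq_true_of_not_eq_false (h2 p hp))
      · push Not at h1
        rcases Y.eq_empty_or_nonempty with rfl | hne
        · exact Or.inr (Or.inl (by simp))
        · exact Or.inr (Or.inr ⟨fun p hp => Bool.eq_false_of_not_eq_true (h1 p hp), hne⟩)
    rcases A.eq_empty_or_nonempty with rfl | ⟨p₀, hp₀⟩
    · simpa using nB
    rcases B.eq_empty_or_nonempty with rfl | ⟨r₀, hr₀⟩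
    · simpa using nA
    -- `A` and `B` have both labels, only `true`, or only `false`
    rcases split A with ⟨At, Af⟩ | At | ⟨Af, -⟩ <;> rcases split B with ⟨Bt, Bf⟩ | Bt | ⟨Bf, -⟩
    · have := (X.left_true Bt).card_le_two (X.left_false Bf) iA
      have := (X.right_false Af).card_le_two (X.right_true At) iB
      omega
    · have := (X.right_false Af).card_le_one (X.right_true At) iB _ Bt
      have := hL.card_le_of_steepLabelling sL cA (X.left_true ⟨r₀, hr₀, Bt r₀ hr₀⟩) At Af
      omega
    · have := (X.right_false Af).card_le_one (X.right_true At) iB _ Bf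
      exact (thinUnion (X.left_false ⟨r₀, hr₀, Bf r₀ hr₀⟩) (X.right_true At)).trans hN2
    · exact (thinUnion (X.left_false Bf) (X.right_true ⟨p₀, hp₀, At p₀ hp₀⟩)).trans hN2
    · have := hL.cup A sL c cA ((X.left_true ⟨r₀, hr₀, Bt r₀ hr₀⟩).isBundle _ At) At
      have := hR.thin_cup B sR c cB (X.right_true ⟨p₀, hp₀, At p₀ hp₀⟩) Bt
      omega
    · exact (thinUnion (X.left_false ⟨r₀, hr₀, Bf r₀ hr₀⟩)
        (X.right_true ⟨p₀, hp₀, At p₀ hp₀⟩)).trans hN2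
    · have := (X.left_true Bt).card_le_one (X.left_false Bf) iA _ Af
      have := hR.card_le_of_steepLabelling sR cB (X.right_false ⟨p₀, hp₀, Af p₀ hp₀⟩) Bt Bf
      omega
    · have := hL.cap A sL c cA ((X.left_true ⟨r₀, hr₀, Bt r₀ hr₀⟩).isBundle _ Af) Af
      have := hR.cup B sR c cB ((X.right_false ⟨p₀, hp₀, Af p₀ hp₀⟩).isBundle _ Bt) Bt
      omega
    · have := hR.cap B sR c cB ((X.right_false ⟨p₀, hp₀, Af p₀ hp₀⟩).isBundle _ Bf) Bf
      have := hL.thin_cap A sL c cA (X.left_false ⟨r₀, hr₀, Bf r₀ hr₀⟩) Af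
      omega

/-! ### Existence of large bundled sets -/

lemma Bundled.translate (h : Bundled l a b m n n' N X) (u v : ℝ) :
    Bundled l a b m n n' N (X.image (move u v 0)) := by
  have inj := move_injective u v 0
  have hlt : ∀ p q, (move u v 0 p).slope < (move u v 0 q).slope ↔ p.slope < q.slope := by
    intro p q
    simp [move]
  have hB : ∀ {T}, IsBundle (T.image (move u v 0)) → IsBundle T := by
    intro T hb p hp q hq hpq
    rw [← chord_translate u v]
    exact hb _ (Finset.mem_image_of_mem _ hp) _ (Finset.mem_image_of_mem _ hq) ((hlt p q).2 hpq)
  have hT : ∀ {T c}, ThinLabelling (T.image (move u v 0)) c →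
      ThinLabelling T (c ∘ move u v 0) := by
    intro T c hb p hp q hq hpq
    rw [← chord_translate u v]
    exact hb _ (Finset.mem_image_of_mem _ hp) _ (Finset.mem_image_of_mem _ hq) ((hlt p q).2 hpq)
  have hall : ∀ {T : Finset NonverticalLine} {c : NonverticalLine → Bool} {u' : Bool},
      (∀ p ∈ T.image (move u v 0), c p = u') →
      ∀ p ∈ T, (c ∘ move u v 0) p = u' := fun h p hp => h _ (Finset.mem_image_of_mem _ hp)
  refine ⟨h.inj.move u v 0, ?_, ?_, ?_, ?_, ?_, ?_, ?_, ?_, ?_, ?_, ?_⟩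
  rotate_left 1
  · intro p hp q hq
    obtain ⟨p, hp', rfl⟩ := Finset.mem_image.1 hp
    obtain ⟨q, hq', rfl⟩ := Finset.mem_image.1 hq
    rw [chord_translate, hlt]
    exact h.ne_zero p hp' q hq'
  · intro p hp q hq r hr
    obtain ⟨p, hp', rfl⟩ := Finset.mem_image.1 hp
    obtain ⟨q, hq', rfl⟩ := Finset.mem_image.1 hq
    obtain ⟨r, hr', rfl⟩ := Finset.mem_image.1 hr
    rw [chord_translate, chord_translate, chord_translate, inj.ne_iff]
    exact h.trans p hp' q hq' r hr'
  rotate_right 1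
  all_goals
    intro S hS
    obtain ⟨T, hTX, rfl⟩ := Finset.subset_image_iff.1 hS
    rw [Finset.card_image_of_injective _ inj]
  · exact fun hc => h.conc T hTX hc.of_move
  · exact fun c hc hb hl => h.cup T hTX _ hc.of_move (hB hb) (hall hl)
  · exact fun c hc hb hl => h.cap T hTX _ hc.of_move (hB hb) (hall hl)
  · rintro c hc hb hl ⟨z, hz, hzT⟩
    obtain ⟨z, hz', rfl⟩ := Finset.mem_image.1 hz
    refine h.cap_of_right T hTX _ hc.of_move (hB hb) (hall hl) ⟨z, hz', fun p hp => ?_⟩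
    have := hzT _ (Finset.mem_image_of_mem _ hp)
    rwa [hlt, chord_translate] at this
  · intro c hc hb hs ht hf
    refine h.sep T hTX _ hc.of_move (hB hb) (fun p hp q hq hpq => ?_) (by simpa using ht)
      (by simpa using hf)
    exact hs _ (Finset.mem_image_of_mem _ hp) _ (Finset.mem_image_of_mem _ hq) ((hlt p q).2 hpq)
  · exact fun c hc ht hl => h.thin_cup T hTX _ hc.of_move (hT ht) (hall hl)
  · exact fun c hc ht hl => h.thin_cap T hTX _ hc.of_move (hT ht) (hall hl)
  · exact fun c hc ht => h.thin T hTX _ hc.of_move (hT ht)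
  · exact fun c hc => h.cell T hTX _ hc.of_move

/-- The positive chords of a finite set are bounded away from `0`. -/
lemma exists_lt_chord (X : Finset NonverticalLine) :
    ∃ δ : ℝ, 0 < δ ∧ ∀ p ∈ X, ∀ q ∈ X, 0 < chord p q → δ < chord p q := by
  have key : ∀ᶠ δ : ℝ in nhdsWithin 0 (Set.Ioi 0),
      0 < δ ∧ ∀ p ∈ X, ∀ q ∈ X, 0 < chord p q → δ < chord p q := by
    refine (eventually_mem_nhdsWithin.mono fun _ h => h).and ?_
    rw [Filter.eventually_all_finset]
    intro p _
    rw [Filter.eventually_all_finset]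
    intro q _
    by_cases h : 0 < chord p q
    · filter_upwards [nhdsWithin_le_nhds (eventually_lt_nhds h)] with δ hδ _ using hδ
    · exact Filter.Eventually.of_forall fun _ h' => absurd h' h
  exact key.exists

lemma Bundled.exists_union (hl : 3 ≤ l) (ha : 1 ≤ a) (hb : 1 ≤ b) (hn : n ≤ n')
    (hN1 : m + n + 1 ≤ N) (hN2 : a + 1 + (b + 1) ≤ N) (hN3 : n' + b ≤ N)
    (hN4 : m + a ≤ N)
    (hL : Bundled l (a + 1) b m n n N L) (hR : Bundled l a (b + 1) m n n' N R) :
    ∃ X, Bundled l (a + 1) (b + 1) m n n' N X ∧ X.card = L.card + R.card := by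
  obtain ⟨δ, hδ, hδL⟩ := exists_lt_chord L
  obtain ⟨ε, hε, hεR⟩ := exists_lt_chord R
  obtain ⟨u, v, hx⟩ := exists_move L R (lo := 0) (μ := min δ ε / 2) (hi := min δ ε)
    (half_pos (lt_min hδ hε)) (half_lt_self (lt_min hδ hε))
  refine ⟨L ∪ R.image (move u v 0), Bundled.union hl ha hb hn hN1 hN2 hN3 hN4 hL
    (hR.translate u v) (fun p hp q hq h => (min_le_left _ _).trans_lt (hδL p hp q hq h))
    (fun p hp q hq => ?_) hx, ?_⟩
  · obtain ⟨p, hp', rfl⟩ := Finset.mem_image.1 hp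
    obtain ⟨q, hq', rfl⟩ := Finset.mem_image.1 hq
    rw [chord_translate]
    exact fun h => (min_le_right _ _).trans_lt (hεR p hp' q hq' h)
  · rw [Finset.card_union_of_disjoint (disjoint_of_slope_lt fun p hp q hq => (hx p hp q hq).1),
      Finset.card_image_of_injective _ (move_injective _ _ _)]

lemma choose_add_succ_succ (i j : ℕ) : (i + 1 + (j + 1)).choose (i + 1) =
    (i + 1 + j).choose (i + 1) + (i + (j + 1)).choose i := by
  rw [show i + 1 + (j + 1) = (i + (j + 1)) + 1 by ring, Nat.choose_succ_succ,
    show i + 1 + j = i + (j + 1) by ring, add_comm]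

/-- Copies of one set `Y` as bundles. -/
lemma exists_bundled_of_uniform (hl : 3 ≤ l) (hY : CupCapBounded l m n Y)
    (hN1 : m + n + 1 ≤ N) (hN2 : k + k ≤ N) (hN3 : n + k ≤ N) (hN4 : m + k ≤ N) (i j : ℕ)
    (hi : i < k) (hj : j < k) :
    ∃ X, Bundled l (i + 1) (j + 1) m n n N X ∧ X.card = (i + j).choose i * Y.card := by
  induction i generalizing j with
  | zero =>
    obtain ⟨X, hX, h⟩ := hY.exists_bundled (a := 0 + 1) (b := j + 1) (n := n) (N := N) (by omega)
      (by omega) (by omega)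
    exact ⟨X, h, by simpa using hX⟩
  | succ i ihi =>
    induction j with
    | zero =>
      obtain ⟨X, hX, h⟩ := hY.exists_bundled (a := i + 1 + 1) (b := 0 + 1) (n := n) (N := N)
        (by omega) (by omega) (by omega)
      exact ⟨X, h, by simpa using hX⟩
    | succ j ihj =>
      obtain ⟨L, hL, cL⟩ := ihj (by omega)
      obtain ⟨R, hR, cR⟩ := ihi (j + 1) (by omega) hj
      obtain ⟨X, hX, cX⟩ := hL.exists_union hl (by omega) (by omega) le_rfl hN1 (by omega)
        (by omega) (by omega) hR
      exact ⟨X, hX, by rw [cX, cL, cR, choose_add_succ_succ, add_mul]⟩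

/-- Copies of `Y` as bundles, except for the last bundle, which is a copy of `Y'`. -/
lemma exists_bundled_of_last (hl : 3 ≤ l) (hY : CupCapBounded l m n Y)
    (hY' : CupCapBounded l m n' Y') (hn : n ≤ n') (hN : m + n' ≤ N)
    (hN1 : m + n + 1 ≤ N) (hN2 : k + k ≤ N) (hN3 : n' + k ≤ N) (hN4 : m + k ≤ N) (i j : ℕ)
    (hi : i < k) (hj : j < k) :
    ∃ X, Bundled l (i + 1) (j + 1) m n n' N X ∧
      X.card + Y.card = (i + j).choose i * Y.card + Y'.card := by
  induction i generalizing j with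
  | zero =>
    obtain ⟨X, hX, h⟩ := hY'.exists_bundled (a := 0 + 1) (b := j + 1) (n := n) (N := N) (by omega)
      (by omega) (by omega)
    exact ⟨X, h, by simp [hX, add_comm]⟩
  | succ i ihi =>
    rcases j with _ | j
    · obtain ⟨X, hX, h⟩ := hY'.exists_bundled (a := i + 1 + 1) (b := 0 + 1) (n := n) (N := N)
        (by omega) (by omega) (by omega)
      exact ⟨X, h, by simp [hX, add_comm]⟩
    · obtain ⟨L, hL, cL⟩ := exists_bundled_of_uniform hl hY hN1 hN2 (by omega) hN4 (i + 1) j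
        (by omega) (by omega)
      obtain ⟨R, hR, cR⟩ := ihi (j + 1) (by omega) hj
      obtain ⟨X, hX, cX⟩ := hL.exists_union hl (by omega) (by omega) hn hN1 (by omega)
        (by omega) (by omega) hR
      refine ⟨X, hX, ?_⟩
      rw [cX, add_assoc, cR, cL, choose_add_succ_succ, add_mul]
      ring

/-! ### Cells of an arrangement and witnesses on its lines -/

/-- On every line `a ∈ S` there is a point strictly below all other lines labelled `true` and
strictly above all other lines labelled `false`. -/
def HasWitnesses (S : Finset NonverticalLine) (c : NonverticalLine → Bool) : Prop :=
  ∀ a ∈ S, ∃ t : ℝ, ∀ b ∈ S, b ≠ a →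
    if c b then a.slope * t + a.intercept < b.slope * t + b.intercept
    else b.slope * t + b.intercept < a.slope * t + a.intercept

lemma lt_chord_iff {a b : NonverticalLine} (h : a.slope < b.slope) (t : ℝ) :
    -t < chord a b ↔ a.slope * t + a.intercept < b.slope * t + b.intercept := by
  rw [chord, lt_div_iff₀ (sub_pos.2 h)]
  constructor <;> intro <;> linarith

lemma chord_lt_iff {a b : NonverticalLine} (h : a.slope < b.slope) (t : ℝ) :
    chord a b < -t ↔ b.slope * t + b.intercept < a.slope * t + a.intercept := by
  rw [chord, div_lt_iff₀ (sub_pos.2 h)]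
  constructor <;> intro <;> linarith

/-- The chord of the outer points of a triple lies between the two other chords; this and the next
three lemmas state it in the forms used below. -/
lemma chord_lt_chord_iff_right {p q r : NonverticalLine} (hpq : p.slope < q.slope)
    (hqr : q.slope < r.slope) : chord p q < chord p r ↔ chord p q < chord q r := by
  have h1 : 0 < q.slope - p.slope := sub_pos.2 hpq
  have h2 : 0 < r.slope - q.slope := sub_pos.2 hqr
  have h3 : 0 < r.slope - p.slope := by linarith
  rw [chord, chord, chord, div_lt_div_iff₀ h1 h3, div_lt_div_iff₀ h1 h2]
  constructor <;> intro <;> nlinarith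

lemma chord_lt_chord_iff_left {p q r : NonverticalLine} (hpq : p.slope < q.slope)
    (hqr : q.slope < r.slope) : chord p r < chord q r ↔ chord p q < chord q r := by
  have h1 : 0 < q.slope - p.slope := sub_pos.2 hpq
  have h2 : 0 < r.slope - q.slope := sub_pos.2 hqr
  have h3 : 0 < r.slope - p.slope := by linarith
  rw [chord, chord, chord, div_lt_div_iff₀ h3 h2, div_lt_div_iff₀ h1 h2]
  constructor <;> intro <;> nlinarith

lemma chord_gt_chord_iff_right {p q r : NonverticalLine} (hpq : p.slope < q.slope)
    (hqr : q.slope < r.slope) : chord p r < chord p q ↔ chord q r < chord p q := by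
  have h1 : 0 < q.slope - p.slope := sub_pos.2 hpq
  have h2 : 0 < r.slope - q.slope := sub_pos.2 hqr
  have h3 : 0 < r.slope - p.slope := by linarith
  rw [chord, chord, chord, div_lt_div_iff₀ h3 h1, div_lt_div_iff₀ h2 h1]
  constructor <;> intro <;> nlinarith

lemma chord_gt_chord_iff_left {p q r : NonverticalLine} (hpq : p.slope < q.slope)
    (hqr : q.slope < r.slope) : chord q r < chord p r ↔ chord q r < chord p q := by
  have h1 : 0 < q.slope - p.slope := sub_pos.2 hpq
  have h2 : 0 < r.slope - q.slope := sub_pos.2 hqr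
  have h3 : 0 < r.slope - p.slope := by linarith
  rw [chord, chord, chord, div_lt_div_iff₀ h2 h3, div_lt_div_iff₀ h2 h1]
  constructor <;> intro <;> nlinarith

/-- In the dual plane the witness on `a` is a line through the dual point of `a` that separates the
other dual points according to their labels. The witnesses on the first and the last line of a
triple decide its orientation if the other two labels differ, and the witness on the middle line
does so if all labels agree. -/
lemma HasWitnesses.convexLabelling (h : HasWitnesses S c) : ConvexLabelling S c := by
  intro p hp q hq r hr hpq hqr
  have hpr := hpq.trans hqr
  obtain ⟨tp, hp'⟩ := h p hp
  obtain ⟨tq, hq'⟩ := h q hq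
  obtain ⟨tr, hr'⟩ := h r hr
  have p1 := hp' q hq (by rintro rfl; exact lt_irrefl _ hpq)
  have p2 := hp' r hr (by rintro rfl; exact lt_irrefl _ hpr)
  have q1 := hq' p hp (by rintro rfl; exact lt_irrefl _ hpq)
  have q2 := hq' r hr (by rintro rfl; exact lt_irrefl _ hqr)
  have r1 := hr' p hp (by rintro rfl; exact lt_irrefl _ hpr)
  have r2 := hr' q hq (by rintro rfl; exact lt_irrefl _ hqr)
  rw [← lt_chord_iff hpq, ← chord_lt_iff hpq] at p1
  rw [← lt_chord_iff hpr, ← chord_lt_iff hpr] at p2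
  rw [← lt_chord_iff hpq, ← chord_lt_iff hpq] at q1
  rw [← lt_chord_iff hqr, ← chord_lt_iff hqr] at q2
  rw [← lt_chord_iff hpr, ← chord_lt_iff hpr] at r1
  rw [← lt_chord_iff hqr, ← chord_lt_iff hqr] at r2
  have hch : (chord p q < chord p r ∧ chord p r < chord q r) ∨
      (chord p q = chord p r ∧ chord p r = chord q r) ∨
      (chord q r < chord p r ∧ chord p r < chord p q) := by
    have e1 := chord_lt_chord_iff_right hpq hqr
    have e2 := chord_lt_chord_iff_left hpq hqr
    have e3 := chord_gt_chord_iff_right hpq hqr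
    have e4 := chord_gt_chord_iff_left hpq hqr
    rcases lt_trichotomy (chord p q) (chord q r) with h | h | h
    · exact Or.inl ⟨e1.2 h, e2.2 h⟩
    · refine Or.inr (Or.inl ⟨le_antisymm ?_ ?_, le_antisymm ?_ ?_⟩)
      · exact not_lt.1 fun h' => (e3.1 h').ne' h
      · exact not_lt.1 fun h' => (e1.1 h').ne h
      · exact not_lt.1 fun h' => (e4.1 h').ne' h
      · exact not_lt.1 fun h' => (e2.1 h').ne h
    · exact Or.inr (Or.inr ⟨e4.2 h, e3.2 h⟩)
  cases hcp : c p <;> cases hcq : c q <;> cases hcr : c r <;>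
    simp only [hcp, hcq, hcr, if_true, if_false, Bool.false_eq_true, cupLabel, Bool.not_true,
      Bool.not_false, reduceCtorEq] at p1 p2 q1 q2 r1 r2 ⊢
  all_goals
    rcases hch with ⟨h1, h2⟩ | ⟨h1, h2⟩ | ⟨h1, h2⟩ <;> linarith

/-- The height of the line `a` above the point `x`. -/
def height (a : NonverticalLine) (x : ℝ × ℝ) : ℝ := a.slope * x.1 + a.intercept - x.2

lemma continuous_height (a : NonverticalLine) : Continuous (height a) := by
  unfold height
  fun_prop

lemma mem_points_iff {a : NonverticalLine} {x : ℝ × ℝ} : x ∈ a.points ↔ height a x = 0 := by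
  simp only [NonverticalLine.points, Set.mem_ofPred_eq, height, sub_eq_zero, eq_comm]

lemma height_ne_zero {a : NonverticalLine} (ha : a ∈ S) {x : ℝ × ℝ}
    (hx : x ∈ lineComplement S) : height a x ≠ 0 := by
  intro h
  refine hx ?_
  simp only [Set.mem_iUnion]
  exact ⟨a, ha, mem_points_iff.2 h⟩

lemma height_pos_of_mem_closure {a : NonverticalLine} (ha : a ∈ S) {x₀ x : ℝ × ℝ}
    (hx₀ : x₀ ∈ lineComplement S) (hpos : 0 < height a x₀)
    (hx : x ∈ closure (connectedComponentIn (lineComplement S) x₀)) : 0 ≤ height a x := by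
  have hsub : connectedComponentIn (lineComplement S) x₀ ⊆ {x | 0 ≤ height a x} := by
    intro y hy
    by_contra hneg
    obtain ⟨z, hz, hz0⟩ := isPreconnected_connectedComponentIn.intermediate_value hy
      (mem_connectedComponentIn hx₀) (continuous_height a).continuousOn
      ⟨(not_le.1 hneg).le, hpos.le⟩
    exact height_ne_zero ha (connectedComponentIn_subset _ _ hz) hz0
  exact closure_minimal hsub (isClosed_le continuous_const (continuous_height a)) hx

lemma height_neg_of_mem_closure {a : NonverticalLine} (ha : a ∈ S) {x₀ x : ℝ × ℝ}
    (hx₀ : x₀ ∈ lineComplement S) (hneg : height a x₀ < 0)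
    (hx : x ∈ closure (connectedComponentIn (lineComplement S) x₀)) : height a x ≤ 0 := by
  have hsub : connectedComponentIn (lineComplement S) x₀ ⊆ {x | height a x ≤ 0} := by
    intro y hy
    by_contra hpos
    obtain ⟨z, hz, hz0⟩ := isPreconnected_connectedComponentIn.intermediate_value
      (mem_connectedComponentIn hx₀) hy (continuous_height a).continuousOn
      ⟨hneg.le, (not_le.1 hpos).le⟩
    exact height_ne_zero ha (connectedComponentIn_subset _ _ hz) hz0
  exact closure_minimal hsub (isClosed_le (continuous_height a) continuous_const) hx

/-- A line that contains a boundary segment of the cell has a point on that segment which lies on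
no other line; the labels record the sides on which the cell lies. -/
lemma exists_hasWitnesses (hS : SlopeInj S) (h : InConvexPosition S) :
    ∃ c, HasWitnesses S c := by
  obtain ⟨P, ⟨x₀, hx₀, rfl⟩, hcard⟩ := h
  set P := connectedComponentIn (lineComplement S) x₀ with hP
  have hall : ∀ a ∈ S, BoundaryUses P a := by
    have : {a : NonverticalLine | a ∈ S ∧ BoundaryUses P a} = (S : Set NonverticalLine) := by
      refine Set.eq_of_subset_of_ncard_le (fun a ha => ha.1) ?_ S.finite_toSet
      rw [hcard, Set.ncard_coe_finset]
    intro a ha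
    have ha' : a ∈ {a : NonverticalLine | a ∈ S ∧ BoundaryUses P a} := by
      rw [this]
      exact ha
    exact ha'.2
  refine ⟨fun a => decide (0 < height a x₀), fun a ha => ?_⟩
  obtain ⟨p, q, hpq, hseg⟩ := hall a ha
  have key : ∀ p q : ℝ × ℝ, p.1 < q.1 → segment ℝ p q ⊆ a.points ∩ frontier P →
      ∃ t : ℝ, ∀ b ∈ S, b ≠ a → if decide (0 < height b x₀) = true then
        a.slope * t + a.intercept < b.slope * t + b.intercept
        else b.slope * t + b.intercept < a.slope * t + a.intercept := by
    intro p q hpq hseg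
    obtain ⟨t, ⟨ht1, ht2⟩, ht⟩ :=
      (Set.Ioo_infinite hpq).exists_notMem_finset (S.image fun b => -chord a b)
    have hp := (hseg (left_mem_segment ℝ p q)).1
    have hq := (hseg (right_mem_segment ℝ p q)).1
    have hmem : (t, a.slope * t + a.intercept) ∈ segment ℝ p q := by
      have h0 : 0 < q.1 - p.1 := sub_pos.2 hpq
      rw [segment_eq_image]
      refine ⟨(t - p.1) / (q.1 - p.1), ⟨div_nonneg (by linarith) h0.le,
        (div_le_one h0).2 (by linarith)⟩, ?_⟩
      simp only [NonverticalLine.points, Set.mem_ofPred_eq] at hp hq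
      ext
      · simp only [Prod.fst_add, Prod.smul_fst, smul_eq_mul]
        field_simp
        ring
      · simp only [Prod.snd_add, Prod.smul_snd, smul_eq_mul, hp, hq]
        field_simp
        ring
    have hcl := frontier_subset_closure (hseg hmem).2
    refine ⟨t, fun b hb hba => ?_⟩
    have hne : a.slope * t + a.intercept ≠ b.slope * t + b.intercept := by
      intro he
      refine ht (Finset.mem_image.2 ⟨b, hb, ?_⟩)
      have hsl : b.slope - a.slope ≠ 0 :=
        sub_ne_zero.2 fun e => hba (hS b hb a ha e)
      rw [chord, neg_eq_iff_eq_neg, div_eq_iff hsl]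
      linarith
    simp only [decide_eq_true_eq]
    split_ifs with hb0
    · have := height_pos_of_mem_closure hb hx₀ hb0 hcl
      simp only [height] at this
      exact lt_of_le_of_ne (by linarith) hne
    · have := height_neg_of_mem_closure hb hx₀
        (lt_of_le_of_ne (not_lt.1 hb0) (height_ne_zero hb hx₀)) hcl
      simp only [height] at this
      exact lt_of_le_of_ne (by linarith) hne.symm
  have hp := (hseg (left_mem_segment ℝ p q)).1
  have hq := (hseg (right_mem_segment ℝ p q)).1
  rcases lt_trichotomy p.1 q.1 with h | h | h
  · exact key p q h hseg
  · refine absurd (Prod.ext h ?_) hpq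
    simp only [NonverticalLine.points, Set.mem_ofPred_eq] at hp hq
    rw [hp, hq, h]
  · exact key q p h (segment_symm ℝ p q ▸ hseg)

/-- The points below the lines labelled `true` and above the lines labelled `false`. -/
def region (S : Finset NonverticalLine) (c : NonverticalLine → Bool) : Set (ℝ × ℝ) :=
  {x | ∀ a ∈ S, if c a then 0 < height a x else height a x < 0}

lemma convex_region (S : Finset NonverticalLine) (c : NonverticalLine → Bool) :
    Convex ℝ (region S c) := by
  intro x hx y hy α β hα hβ hαβ a ha
  have e : height a (α • x + β • y) = α • height a x + β • height a y := by
    simp only [height, Prod.fst_add, Prod.snd_add, Prod.smul_fst, Prod.smul_snd, smul_eq_mul]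
    linear_combination (-a.intercept) * hαβ
  have h1 := hx a ha
  have h2 := hy a ha
  rw [e]
  split_ifs at h1 h2 ⊢ with h
  · exact convex_Ioi (0 : ℝ) h1 h2 hα hβ hαβ
  · exact convex_Iio (0 : ℝ) h1 h2 hα hβ hαβ

lemma region_subset : region S c ⊆ lineComplement S := by
  intro x hx hmem
  simp only [Set.mem_iUnion] at hmem
  obtain ⟨a, ha, hax⟩ := hmem
  have := hx a ha
  rw [mem_points_iff.1 hax] at this
  simp at this

lemma mem_closure_region {a : NonverticalLine} (t : ℝ)
    (h : ∀ b ∈ S, b ≠ a → if c b then a.slope * t + a.intercept < b.slope * t + b.intercept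
      else b.slope * t + b.intercept < a.slope * t + a.intercept) :
    (t, a.slope * t + a.intercept) ∈ closure (region S c) := by
  set s : ℝ := if c a then -1 else 1 with hs
  set f : ℝ → ℝ × ℝ := fun ε => (t, a.slope * t + a.intercept + s * ε) with hf
  have hfc : Continuous f := by fun_prop
  have hf0 : f 0 = (t, a.slope * t + a.intercept) := by simp [hf]
  rw [← hf0]
  refine mem_closure_of_tendsto (b := nhdsWithin 0 (Set.Ioi 0))
    (hfc.continuousAt.tendsto.mono_left nhdsWithin_le_nhds) ?_
  simp only [region, Set.mem_ofPred_eq]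
  rw [Filter.eventually_all_finset]
  intro b hb
  by_cases hba : b = a
  · subst hba
    filter_upwards [eventually_mem_nhdsWithin] with ε hε
    have hε : 0 < ε := hε
    simp only [height, hf, hs]
    split_ifs <;> linarith
  · have hcont : Continuous fun ε => height b (f ε) := (continuous_height b).comp hfc
    have hb' := h b hb hba
    refine Filter.Eventually.filter_mono nhdsWithin_le_nhds ?_
    by_cases hcb : c b = true
    · rw [if_pos hcb] at hb'
      simp only [hcb, if_true]
      refine hcont.continuousAt.eventually_const_lt ?_
      beta_reduce
      rw [hf0]
      simp only [height]
      linarith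
    · rw [if_neg hcb] at hb'
      simp only [hcb]
      refine hcont.continuousAt.eventually_lt_const ?_
      beta_reduce
      rw [hf0]
      simp only [height]
      linarith

lemma HasWitnesses.inConvexPosition (h : HasWitnesses S c) (hne : S.Nonempty) :
    InConvexPosition S := by
  obtain ⟨a₀, ha₀⟩ := hne
  obtain ⟨t₀, ht₀⟩ := h a₀ ha₀
  obtain ⟨g, hg⟩ : (region S c).Nonempty := closure_nonempty_iff.1 ⟨_, mem_closure_region t₀ ht₀⟩
  have hsub : region S c ⊆ connectedComponentIn (lineComplement S) g :=
    (convex_region S c).isPreconnected.subset_connectedComponentIn hg region_subset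
  refine ⟨connectedComponentIn (lineComplement S) g, ⟨g, region_subset hg, rfl⟩, ?_⟩
  rw [← Set.ncard_coe_finset S]
  congr 1
  ext a
  refine ⟨fun ha => ha.1, fun ha => ⟨ha, ?_⟩⟩
  obtain ⟨t, ht⟩ := h a ha
  have hev : ∀ᶠ t' in nhds t, ∀ b ∈ S, b ≠ a →
      if c b then a.slope * t' + a.intercept < b.slope * t' + b.intercept
      else b.slope * t' + b.intercept < a.slope * t' + a.intercept := by
    rw [Filter.eventually_all_finset]
    intro b hb
    by_cases hba : b = a
    · exact Filter.Eventually.of_forall fun _ h => absurd hba h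
    have hb' := ht b hb hba
    have ca : ∀ b : NonverticalLine, ContinuousAt (fun t' => b.slope * t' + b.intercept) t :=
      fun b => by fun_prop
    by_cases hcb : c b = true
    · rw [if_pos hcb] at hb'
      filter_upwards [(ca a).eventually_lt (ca b) hb'] with t' ht' _
      rwa [if_pos hcb]
    · rw [if_neg hcb] at hb'
      filter_upwards [(ca b).eventually_lt (ca a) hb'] with t' ht' _
      rwa [if_neg hcb]
  obtain ⟨δ, hδ, hball⟩ := Metric.eventually_nhds_iff.1 hev
  refine ⟨(t, a.slope * t + a.intercept), (t + δ / 2, a.slope * (t + δ / 2) + a.intercept), ?_, ?_⟩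
  · intro he
    have := congrArg Prod.fst he
    simp only at this
    linarith
  · intro x hx
    rw [segment_eq_image] at hx
    obtain ⟨θ, ⟨h0, h1⟩, rfl⟩ := hx
    have hx : (1 - θ) • (t, a.slope * t + a.intercept) +
        θ • (t + δ / 2, a.slope * (t + δ / 2) + a.intercept) =
        (t + θ * (δ / 2), a.slope * (t + θ * (δ / 2)) + a.intercept) := by
      ext
      · simp only [Prod.fst_add, Prod.smul_fst, smul_eq_mul]
        ring
      · simp only [Prod.snd_add, Prod.smul_snd, smul_eq_mul]
        ring
    simp only [hx]
    have hmem : (t + θ * (δ / 2), a.slope * (t + θ * (δ / 2)) + a.intercept) ∈ a.points := rfl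
    refine ⟨hmem, closure_mono hsub (mem_closure_region _ (hball ?_)), fun hint => ?_⟩
    · rw [Real.dist_eq, add_sub_cancel_left, abs_of_nonneg (by positivity)]
      nlinarith
    · exact height_ne_zero ha (connectedComponentIn_subset _ _ (interior_subset hint))
        (mem_points_iff.1 hmem)

/-! ### Existence of the minimum -/

/-- No triple of dual points is a strict cap. -/
def IsWeakCup (S : Finset NonverticalLine) : Prop :=
  ∀ p ∈ S, ∀ q ∈ S, ∀ r ∈ S, p.slope < q.slope → q.slope < r.slope → chord p q ≤ chord q r

/-- All triples of dual points are strict caps. -/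
def IsCap (S : Finset NonverticalLine) : Prop :=
  ∀ p ∈ S, ∀ q ∈ S, ∀ r ∈ S, p.slope < q.slope → q.slope < r.slope → chord q r < chord p q

lemma SlopeInj.lt_of_le_of_ne (h : SlopeInj X) {p q : NonverticalLine} (hp : p ∈ X) (hq : q ∈ X)
    (hle : p.slope ≤ q.slope) (hne : p ≠ q) : p.slope < q.slope :=
  _root_.lt_of_le_of_ne hle fun e => hne (h p hp q hq e)

lemma IsWeakCup.insert_right (h : IsWeakCup C) (hC : SlopeInj C) {z v : NonverticalLine}
    (hz : z ∈ C)
    (hmax : ∀ p ∈ C, p.slope ≤ z.slope) (hv : z.slope < v.slope)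
    (hzv : ∀ p ∈ C, p ≠ z → chord p z ≤ chord z v) : IsWeakCup (insert v C) := by
  have hlt : ∀ p ∈ C, p.slope < v.slope := fun p hp => (hmax p hp).trans_lt hv
  intro p hp q hq r hr hpq hqr
  rcases Finset.mem_insert.1 hp with rfl | hp' <;>
    rcases Finset.mem_insert.1 hq with rfl | hq' <;>
    rcases Finset.mem_insert.1 hr with rfl | hr'
  · exact absurd hpq (lt_irrefl _)
  · exact absurd hpq (lt_irrefl _)
  · exact absurd (hpq.trans hqr) (lt_irrefl _)
  · exact absurd hpq (hlt q hq').not_gt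
  · exact absurd hqr (lt_irrefl _)
  · exact absurd hqr (hlt r hr').not_gt
  · by_cases hqz : q = z
    · subst hqz
      exact hzv p hp' (by rintro rfl; exact lt_irrefl _ hpq)
    · have hqz' := hC.lt_of_le_of_ne hq' hz (hmax q hq') hqz
      refine (h p hp' q hq' z hz hpq hqz').trans (not_lt.1 fun hcon => ?_)
      exact ((chord_gt_chord_iff_right hqz' hv).1 hcon).not_ge (hzv q hq' hqz)
  · exact h p hp' q hq' r hr' hpq hqr

lemma IsCap.insert_left (h : IsCap C) (hC : SlopeInj C) {z w : NonverticalLine} (hz : z ∈ C)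
    (hmin : ∀ p ∈ C, z.slope ≤ p.slope) (hw : w.slope < z.slope)
    (hwz : ∀ p ∈ C, p ≠ z → chord z p < chord w z) : IsCap (insert w C) := by
  have hlt : ∀ p ∈ C, w.slope < p.slope := fun p hp => hw.trans_le (hmin p hp)
  intro p hp q hq r hr hpq hqr
  rcases Finset.mem_insert.1 hp with rfl | hp' <;>
    rcases Finset.mem_insert.1 hq with rfl | hq' <;>
    rcases Finset.mem_insert.1 hr with rfl | hr'
  · exact absurd hpq (lt_irrefl _)
  · exact absurd hpq (lt_irrefl _)
  · exact absurd (hpq.trans hqr) (lt_irrefl _)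
  · by_cases hqz : q = z
    · subst hqz
      exact hwz r hr' (by rintro rfl; exact lt_irrefl _ hqr)
    · have hzq := hC.lt_of_le_of_ne hz hq' (hmin q hq') (Ne.symm hqz)
      exact (h z hz q hq' r hr' hzq hqr).trans
        ((chord_gt_chord_iff_left hw hzq).2 (hwz q hq' hqz))
  · exact absurd hqr (lt_irrefl _)
  · exact absurd hpq (hlt p hp').not_gt
  · exact absurd hqr (hlt q hq').not_gt
  · exact h p hp' q hq' r hr' hpq hqr

/-- The Erdős–Szekeres theorem on cups and caps, for dual points that may be collinear. -/
lemma exists_weakCup_or_cap (a b : ℕ) : ∃ N : ℕ, ∀ X : Finset NonverticalLine, SlopeInj X →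
    N ≤ X.card → (∃ S ⊆ X, S.card = a + 2 ∧ IsWeakCup S) ∨
      (∃ S ⊆ X, S.card = b + 2 ∧ IsCap S) := by
  have two : ∀ S : Finset NonverticalLine, SlopeInj S → S.card = 2 →
      ∀ p ∈ S, ∀ q ∈ S, ∀ r ∈ S, p.slope < q.slope → q.slope < r.slope → False := by
    intro S _ hS p hp q hq r hr hpq hqr
    have : 2 < S.card := Finset.two_lt_card.2 ⟨p, hp, q, hq, r, hr,
      by rintro rfl; exact lt_irrefl _ hpq, by rintro rfl; exact lt_asymm hpq hqr,
      by rintro rfl; exact lt_irrefl _ hqr⟩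
    omega
  induction a generalizing b with
  | zero =>
    refine ⟨2, fun X hX hN => Or.inl ?_⟩
    obtain ⟨S, hS, hc⟩ := Finset.exists_subset_card_eq hN
    exact ⟨S, hS, hc, fun p hp q hq r hr h1 h2 =>
      (two S (hX.mono hS) hc p hp q hq r hr h1 h2).elim⟩
  | succ a iha =>
    induction b with
    | zero =>
      refine ⟨2, fun X hX hN => Or.inr ?_⟩
      obtain ⟨S, hS, hc⟩ := Finset.exists_subset_card_eq hN
      exact ⟨S, hS, hc, fun p hp q hq r hr h1 h2 =>
        (two S (hX.mono hS) hc p hp q hq r hr h1 h2).elim⟩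
    | succ b ihb =>
      obtain ⟨N₁, h₁⟩ := iha (b + 1)
      obtain ⟨N₂, h₂⟩ := ihb
      refine ⟨N₁ + N₂, fun X hX hN => ?_⟩
      classical
      -- `P z`: the point `z` is the last one of a weak cup of `a + 2` points
      set P : NonverticalLine → Prop := fun z => ∃ C ⊆ X, C.card = a + 2 ∧ IsWeakCup C ∧ z ∈ C ∧
        ∀ p ∈ C, p.slope ≤ z.slope with hP
      have hsum := Finset.card_filter_add_card_filter_not (s := X) P
      have sP : X.filter P ⊆ X := Finset.filter_subset _ _
      have sP' : X.filter (fun z => ¬ P z) ⊆ X := Finset.filter_subset _ _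
      by_cases hcase : N₁ ≤ (X.filter fun z => ¬ P z).card
      · rcases h₁ _ (hX.mono sP') hcase with ⟨C, hC, hCc, hCup⟩ | ⟨S, hS, hSc⟩
        · obtain ⟨z, hz, hmax⟩ := C.exists_max_image (fun p => p.slope)
            (Finset.card_pos.1 (by omega))
          exact absurd ⟨C, hC.trans sP', hCc, hCup, hz, hmax⟩ (Finset.mem_filter.1 (hC hz)).2
        · exact Or.inr ⟨S, hS.trans sP', hSc⟩
      · rcases h₂ _ (hX.mono sP) (by omega) with ⟨C, hC, hCc⟩ | ⟨S, hS, hSc, hScap⟩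
        · exact Or.inl ⟨C, hC.trans sP, hCc⟩
        · obtain ⟨z, hz, hmin⟩ := S.exists_min_image (fun p => p.slope)
            (Finset.card_pos.1 (by omega))
          obtain ⟨C, hC, hCc, hCup, hzC, hmax⟩ := (Finset.mem_filter.1 (hS hz)).2
          obtain ⟨w, hw, hwmax⟩ := (C.erase z).exists_max_image (fun p => chord p z)
            (Finset.card_pos.1 (by rw [Finset.card_erase_of_mem hzC]; omega))
          obtain ⟨hwz, hwC⟩ := Finset.mem_erase.1 hw
          have hSX := hS.trans sP
          have hzlt : ∀ p ∈ S, p ≠ z → z.slope < p.slope := fun p hp hne =>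
            hX.lt_of_le_of_ne (hSX hz) (hSX hp) (hmin p hp) hne.symm
          have hwlt : w.slope < z.slope :=
            hX.lt_of_le_of_ne (hC hwC) (hC hzC) (hmax w hwC) hwz
          -- either some `v` in the cap `S` extends the weak cup `C`, or `w` extends `S`
          by_cases hv : ∃ v ∈ S, v ≠ z ∧ chord w z ≤ chord z v
          · obtain ⟨v, hvS, hvz, hle⟩ := hv
            have hzv := hzlt v hvS hvz
            refine Or.inl ⟨insert v C, Finset.insert_subset (hSX hvS) hC, ?_,
              hCup.insert_right (hX.mono hC) hzC hmax hzv fun p hp hpz =>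
                (hwmax p (Finset.mem_erase.2 ⟨hpz, hp⟩)).trans hle⟩
            rw [Finset.card_insert_of_notMem fun hvC => (hmax v hvC).not_gt hzv, hCc]
          · push Not at hv
            refine Or.inr ⟨insert w S, Finset.insert_subset (hC hwC) hSX, ?_,
              hScap.insert_left (hX.mono hSX) hz hmin hwlt hv⟩
            rw [Finset.card_insert_of_notMem fun hwS => (hmin w hwS).not_gt hwlt, hSc]

/-- A set of lines has a subset of any admissible size that consists of its largest slopes. -/
lemma exists_top (hW : SlopeInj W) {k : ℕ} (hk : k ≤ W.card) :
    ∃ T ⊆ W, T.card = k ∧ ∀ p ∈ W \ T, ∀ q ∈ T, p.slope < q.slope := by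
  induction k with
  | zero => exact ⟨∅, by simp⟩
  | succ k ih =>
    obtain ⟨T, hT, hTc, htop⟩ := ih (by omega)
    obtain ⟨m, hm, hmax⟩ := (W \ T).exists_max_image (fun p => p.slope)
      (Finset.card_pos.1 (by rw [Finset.card_sdiff_of_subset hT]; omega))
    obtain ⟨hmW, hmT⟩ := Finset.mem_sdiff.1 hm
    refine ⟨insert m T, Finset.insert_subset hmW hT, ?_, fun p hp q hq => ?_⟩
    · rw [Finset.card_insert_of_notMem hmT, hTc]
    · rw [Finset.mem_sdiff, Finset.mem_insert, not_or] at hp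
      have hp' : p ∈ W \ T := Finset.mem_sdiff.2 ⟨hp.1, hp.2.2⟩
      rcases Finset.mem_insert.1 hq with rfl | hq
      · exact hW.lt_of_le_of_ne hp.1 hmW (hmax p hp') hp.2.1
      · exact htop p hp' q hq

/-- A weak cup with at most `l - 1` collinear points contains large strict cups: the points of a
strict cup are chosen with `l - 1` points of the weak cup skipped between them. -/
lemma IsWeakCup.exists_convexLabelling {l : ℕ} (hl : 1 ≤ l)
    (hconc : ∀ S ⊆ X, Concurrent S → S.card < l) (hX : SlopeInj X) (n : ℕ) :
    ∀ W ⊆ X, IsWeakCup W → n * l ≤ W.card →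
      ∃ S ⊆ W, S.card = n ∧ ConvexLabelling S fun _ => true := by
  induction n with
  | zero => exact fun W _ _ _ => ⟨∅, by simp, by simp, by simp [ConvexLabelling]⟩
  | succ n ih =>
    intro W hWX hW hcard
    rw [add_mul, one_mul] at hcard
    obtain ⟨T, hT, hTc, htop⟩ := exists_top (hX.mono hWX) (show l ≤ W.card by omega)
    have hsub : W \ T ⊆ W := Finset.sdiff_subset
    obtain ⟨C, hC, hCc, hCl⟩ := ih (W \ T) (hsub.trans hWX)
      (fun p hp q hq r hr => hW p (hsub hp) q (hsub hq) r (hsub hr))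
      (by rw [Finset.card_sdiff_of_subset hT]; omega)
    obtain ⟨z, hz, hmax⟩ := T.exists_max_image (fun p => p.slope)
      (Finset.card_pos.1 (by omega))
    have hlt : ∀ p ∈ C, p.slope < z.slope := fun p hp => htop p (hC hp) z hz
    refine ⟨insert z C, Finset.insert_subset (hT hz) (hC.trans hsub), ?_, ?_⟩
    · rw [Finset.card_insert_of_notMem fun h => lt_irrefl _ (hlt z h), hCc]
    intro p hp q hq r hr hpq hqr
    have hgoal : chord p q < chord q r := by
      rcases Finset.mem_insert.1 hp with rfl | hp'
      · rcases Finset.mem_insert.1 hq with rfl | hq'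
        · exact absurd hpq (lt_irrefl _)
        · exact absurd hpq (hlt q hq').not_gt
      rcases Finset.mem_insert.1 hq with rfl | hq'
      · rcases Finset.mem_insert.1 hr with rfl | hr'
        · exact absurd hqr (lt_irrefl _)
        · exact absurd hqr (hlt r hr').not_gt
      rcases Finset.mem_insert.1 hr with rfl | hr'
      swap
      · simpa [cupLabel] using hCl p hp' q hq' r hr' hpq hqr
      have hpW := hsub (hC hp')
      have hqW := hsub (hC hq')
      refine lt_of_le_of_ne (hW p hpW q hqW r (hT hz) hpq hqr) fun heq => ?_
      -- equality would put all of `T` on the line through the dual points of `p` and `q`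
      have hw : ∀ w ∈ T, chord q w = chord p q := by
        intro w hw
        have hqw := htop q (hC hq') w hw
        refine le_antisymm ?_ (hW p hpW q hqW w (hT hw) hpq hqw)
        by_cases hwr : w = r
        · rw [hwr, heq]
        have hwr' := hX.lt_of_le_of_ne (hWX (hT hw)) (hWX (hT hz)) (hmax w hw) hwr
        have hle := hW q hqW w (hT hw) r (hT hz) hqw hwr'
        rw [heq]
        refine not_lt.1 fun hcon => ?_
        exact ((chord_gt_chord_iff_right hqw hwr').1 hcon).not_ge hle
      have hcc : Concurrent T := by
        refine ⟨-chord p q, q.slope * (-chord p q) + q.intercept, fun w hwT => ?_⟩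
        have h1 := hw w hwT
        rw [chord, div_eq_iff (sub_ne_zero.2 (htop q (hC hq') w hwT).ne')] at h1
        linarith
      have := hconc T (hT.trans hWX) hcc
      omega
    simpa [cupLabel] using hgoal

/-- A strict cup or cap bounds a cell that lies below or above all its lines. -/
lemma hasWitnesses_of_const (hS : SlopeInj S) (u : Bool) (h : ConvexLabelling S fun _ => u) :
    HasWitnesses S fun _ => u := by
  intro a ha
  have hA : ∀ b ∈ S.filter (fun b => b.slope < a.slope), b ∈ S ∧ b.slope < a.slope :=
    fun b hb => Finset.mem_filter.1 hb
  have hB : ∀ b ∈ S.filter (fun b => a.slope < b.slope), b ∈ S ∧ a.slope < b.slope :=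
    fun b hb => Finset.mem_filter.1 hb
  cases u with
  | true =>
    obtain ⟨τ, h1, h2⟩ := Order.exists_between_finsets
      ((S.filter fun b => b.slope < a.slope).image fun b => chord b a)
      ((S.filter fun b => a.slope < b.slope).image fun b => chord a b) (by
        intro x hx y hy
        obtain ⟨p, hp, rfl⟩ := Finset.mem_image.1 hx
        obtain ⟨q, hq, rfl⟩ := Finset.mem_image.1 hy
        simpa [cupLabel] using
          h p (hA p hp).1 a ha q (hB q hq).1 (hA p hp).2 (hB q hq).2)
    refine ⟨-τ, fun b hb hba => ?_⟩
    simp only [if_true]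
    rcases hS.lt_or_gt hb ha hba with hlt | hlt
    · rw [← chord_lt_iff hlt, neg_neg]
      exact h1 _ (Finset.mem_image_of_mem _ (Finset.mem_filter.2 ⟨hb, hlt⟩))
    · rw [← lt_chord_iff hlt, neg_neg]
      exact h2 _ (Finset.mem_image_of_mem _ (Finset.mem_filter.2 ⟨hb, hlt⟩))
  | false =>
    obtain ⟨τ, h1, h2⟩ := Order.exists_between_finsets
      ((S.filter fun b => a.slope < b.slope).image fun b => chord a b)
      ((S.filter fun b => b.slope < a.slope).image fun b => chord b a) (by
        intro y hy x hx
        obtain ⟨p, hp, rfl⟩ := Finset.mem_image.1 hx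
        obtain ⟨q, hq, rfl⟩ := Finset.mem_image.1 hy
        simpa [cupLabel] using
          h p (hA p hp).1 a ha q (hB q hq).1 (hA p hp).2 (hB q hq).2)
    refine ⟨-τ, fun b hb hba => ?_⟩
    simp only [Bool.false_eq_true, if_false]
    rcases hS.lt_or_gt hb ha hba with hlt | hlt
    · rw [← lt_chord_iff hlt, neg_neg]
      exact h2 _ (Finset.mem_image_of_mem _ (Finset.mem_filter.2 ⟨hb, hlt⟩))
    · rw [← chord_lt_iff hlt, neg_neg]
      exact h1 _ (Finset.mem_image_of_mem _ (Finset.mem_filter.2 ⟨hb, hlt⟩))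

lemma slopeInj_iff : SlopeInj F ↔ NearlyGeneralPosition F := by
  refine forall₄_congr fun p _ q _ => ?_
  tauto

lemma hasConcurrent_iff {l : ℕ} :
    HasConcurrent F l ↔ ∃ S ⊆ F, S.card = l ∧ Concurrent S := by
  refine exists_congr fun S => and_congr_right fun _ => and_congr_right fun _ => ?_
  rw [Prod.exists]
  refine exists₂_congr fun t y => forall₂_congr fun a _ => ?_
  exact eq_comm

lemma exists_forall_hasConcurrent_or_hasConvex {l n : ℕ} (hl : 1 ≤ l) (hn : 1 ≤ n) :
    ∃ N : ℕ, ∀ F : Finset NonverticalLine, F.card = N → NearlyGeneralPosition F →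
      HasConcurrent F l ∨ HasConvex F n := by
  obtain ⟨N, hN⟩ := exists_weakCup_or_cap (n * l) n
  refine ⟨N, fun F hF hgen => ?_⟩
  rw [← slopeInj_iff] at hgen
  rw [hasConcurrent_iff, or_iff_not_imp_left]
  intro hnot
  have hconc : ∀ S ⊆ F, Concurrent S → S.card < l := by
    intro S hS hc
    by_contra! hle
    obtain ⟨T, hT, hTc⟩ := Finset.exists_subset_card_eq hle
    exact hnot ⟨T, hT.trans hS, hTc, hc.mono hT⟩
  have hconst : ∃ S ⊆ F, ∃ u : Bool, S.card = n ∧ ConvexLabelling S fun _ => u := by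
    rcases hN F hgen hF.ge with ⟨W, hW, hWc, hcup⟩ | ⟨W, hW, hWc, hcap⟩
    · obtain ⟨S, hS, hSc, h⟩ :=
        IsWeakCup.exists_convexLabelling hl hconc hgen n W hW hcup (by omega)
      exact ⟨S, hS.trans hW, true, hSc, h⟩
    · obtain ⟨S, hS, hSc⟩ := Finset.exists_subset_card_eq (show n ≤ W.card by omega)
      refine ⟨S, hS.trans hW, false, hSc, fun p hp q hq r hr hpq hqr => ?_⟩
      simpa [cupLabel] using hcap p (hS hp) q (hS hq) r (hS hr) hpq hqr
  obtain ⟨S, hS, u, hSc, h⟩ := hconst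
  exact ⟨S, hS, hSc, (hasWitnesses_of_const (hgen.mono hS) u h).inConvexPosition
    (Finset.card_pos.1 (by omega))⟩

/-! ### The bounds -/

/-- A family without `l` concurrent and `n` convex lines is smaller than the minimum; by
`exists_forall_hasConcurrent_or_hasConvex` the infimum in `ESL` is attained. -/
lemma card_lt_ESL (hl : 1 ≤ l) (hn : 1 ≤ n) (hF : NearlyGeneralPosition F)
    (h1 : ¬ HasConcurrent F l) (h2 : ¬ HasConvex F n) : F.card < ESL l n := by
  by_contra! hle
  obtain ⟨G, hG, hGc⟩ := Finset.exists_subset_card_eq hle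
  have hmem : ESL l n ∈ {N : ℕ | ∀ F : Finset NonverticalLine, F.card = N →
      NearlyGeneralPosition F → HasConcurrent F l ∨ HasConvex F n} :=
    Nat.sInf_mem (exists_forall_hasConcurrent_or_hasConvex hl hn)
  rcases hmem G hGc fun a ha b hb => hF a (hG ha) b (hG hb) with ⟨S, hS, h⟩ | ⟨S, hS, h⟩
  · exact h1 ⟨S, hS.trans hG, h⟩
  · exact h2 ⟨S, hS.trans hG, h⟩

lemma Bundled.card_lt_ESL {a b m n n' N r : ℕ} (h : Bundled l a b m n n' N X) (hl : 1 ≤ l)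
    (hN : N < r) : X.card < ESL l r := by
  refine LinesES.card_lt_ESL hl (by omega) (slopeInj_iff.1 h.inj) ?_ ?_
  · rw [hasConcurrent_iff]
    rintro ⟨S, hS, hSc, hconc⟩
    exact (h.conc S hS hconc).ne hSc
  · rintro ⟨S, hS, hSc, hconv⟩
    obtain ⟨c, hc⟩ := exists_hasWitnesses (h.inj.mono hS) hconv
    have := h.cell S hS c hc.convexLabelling
    omega

lemma cupCapBounded_singleton (hl : 2 ≤ l) {a b : ℕ} (ha : 1 ≤ a) (hb : 1 ≤ b)
    (p : NonverticalLine) : CupCapBounded l a b {p} := by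
  have hcard : ∀ S ⊆ ({p} : Finset NonverticalLine), S.card ≤ 1 :=
    fun S hS => by simpa using Finset.card_le_card hS
  refine ⟨?_, fun S hS _ => (hcard S hS).trans_lt (by omega),
    fun S hS _ _ _ => (hcard S hS).trans ha, fun S hS _ _ _ => (hcard S hS).trans hb,
    fun S hS _ _ => (hcard S hS).trans (by omega),
    fun S hS _ _ _ _ _ => (hcard S hS).trans (by omega)⟩
  intro x hx y hy _
  rw [Finset.mem_singleton.1 hx, Finset.mem_singleton.1 hy]

lemma two_mul_choose (m : ℕ) : 2 * (2 * m + 1).choose (m + 1) = (2 * m + 2).choose (m + 1) := by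
  rw [Nat.choose_succ_succ (2 * m + 1), two_mul, add_left_inj]
  exact Nat.choose_symm_half m

/-- All bundles have cups and caps of at most `i + 2` points, so cells have at most `2 (i + 2) + 1`
lines. -/
lemma even_bound (hl : 3 ≤ l) (i : ℕ) :
    ∃ X : Finset NonverticalLine, X.card < ESL l (2 * (i + 2) + 2) ∧
      (l - 1) * (2 * i + 2).choose (i + 1) ^ 2 ≤
        2 * X.card + (l - 3) * ((2 * i).choose i * (2 * i + 2).choose (i + 1)) := by
  obtain ⟨Y, hY, cY⟩ := exists_cupCapBounded hl i i
  obtain ⟨X, hX, cX⟩ := exists_bundled_of_uniform (N := 2 * (i + 2) + 1) (k := i + 2) hl hY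
    (by omega) (by omega) (by omega) (by omega) (i + 1) (i + 1) (by omega) (by omega)
  refine ⟨X, hX.card_lt_ESL (by omega) (by omega), ?_⟩
  rw [cX]
  rw [show i + 1 + (i + 1) = 2 * i + 2 by ring]
  rw [← two_mul] at cY
  calc _ = (2 * i + 2).choose (i + 1) * ((l - 1) * (2 * i + 2).choose (i + 1)) := by ring
    _ ≤ (2 * i + 2).choose (i + 1) * (2 * Y.card + (l - 3) * (2 * i).choose i) := by gcongr
    _ = _ := by ring

/-- All bundles but the last have caps of at most `i + 1` points, so cells have at most `2 (i + 2)`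
lines. -/
lemma odd_bound (hl : 3 ≤ l) (i : ℕ) :
    ∃ X : Finset NonverticalLine, X.card < ESL l (2 * (i + 2) + 1) ∧
      (l - 1) * (((2 * i + 2).choose (i + 1) + 1) * (2 * i + 1).choose (i + 1)) ≤
        2 * X.card + (l - 3) * ((2 * i).choose i * (2 * i + 2).choose (i + 1)) := by
  obtain ⟨Y', hY', cY'⟩ := exists_cupCapBounded hl i i
  have hsmall : ∃ Y, CupCapBounded l (i + 2) (i + 1) Y ∧
      (l - 1) * (2 * i + 1).choose (i + 1) ≤ 2 * Y.card + (l - 3) * (2 * i).choose i := by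
    rcases i with _ | i
    · exact ⟨{⟨0, 0⟩}, cupCapBounded_singleton (by omega) (by omega) (by omega) _, by simp; omega⟩
    · obtain ⟨Y, hY, cY⟩ := exists_cupCapBounded hl (i + 1) i
      refine ⟨Y, hY, ?_⟩
      rw [show i + 1 + i + 2 = 2 * (i + 1) + 1 by ring, show i + 1 + i = 2 * i + 1 by ring] at cY
      refine cY.trans (Nat.add_le_add_left (Nat.mul_le_mul_left _ ?_) _)
      have := two_mul_choose i
      rw [show 2 * (i + 1) = 2 * i + 2 by ring]
      omega
  obtain ⟨Y, hY, cY⟩ := hsmall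
  obtain ⟨X, hX, cX⟩ := exists_bundled_of_last (N := 2 * (i + 2)) (k := i + 2) hl hY hY'
    (by omega) (by omega) (by omega) (by omega) (by omega) (by omega) (i + 1) (i + 1)
    (by omega) (by omega)
  refine ⟨X, hX.card_lt_ESL (by omega) (by omega), ?_⟩
  rw [show i + 1 + (i + 1) = 2 * i + 2 by ring] at cX
  rw [← two_mul] at cY'
  have hB := two_mul_choose i
  obtain ⟨b, hb⟩ : ∃ b, (2 * i + 2).choose (i + 1) = b + 1 :=
    Nat.exists_eq_add_of_le' (Nat.choose_pos (by omega))
  rw [hb] at cX cY' hB ⊢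
  generalize (2 * i + 1).choose (i + 1) = H at *
  generalize (2 * i).choose i = A at *
  have hXc : X.card = b * Y.card + Y'.card := by
    rw [add_mul] at cX
    omega
  rw [hXc]
  calc (l - 1) * ((b + 1 + 1) * H) = b * ((l - 1) * H) + (l - 1) * (2 * H) := by ring
    _ ≤ b * (2 * Y.card + (l - 3) * A) + (2 * Y'.card + (l - 3) * A) := by
      rw [hB]
      gcongr
    _ = _ := by ring

end LinesES

theorem proposition3p2 (k l : ℕ) (hk : 2 ≤ k) (hl : 3 ≤ l) :
    (((l : ℝ) - 1) / 2 * ((2 * k - 2).choose (k - 1) : ℝ) ^ 2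
        - ((l : ℝ) - 3) / 2 * ((2 * k - 4).choose (k - 2) : ℝ) * ((2 * k - 2).choose (k - 1) : ℝ)
      < (LinesES.ESL l (2 * k + 2) : ℝ)) ∧
    (((l : ℝ) - 1) / 2 * (((2 * k - 2).choose (k - 1) : ℝ) + 1) * ((2 * k - 3).choose (k - 1) : ℝ)
        - ((l : ℝ) - 3) / 2 * ((2 * k - 4).choose (k - 2) : ℝ) * ((2 * k - 2).choose (k - 1) : ℝ)
      < (LinesES.ESL l (2 * k + 1) : ℝ)) := by
  obtain ⟨i, rfl⟩ := Nat.exists_eq_add_of_le' hk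
  obtain ⟨j, rfl⟩ := Nat.exists_eq_add_of_le' hl
  rw [show 2 * (i + 2) - 2 = 2 * i + 2 by omega, show 2 * (i + 2) - 4 = 2 * i by omega,
    show 2 * (i + 2) - 3 = 2 * i + 1 by omega, show i + 2 - 1 = i + 1 by omega,
    show i + 2 - 2 = i by omega]
  constructor
  · obtain ⟨X, hX, hcard⟩ := LinesES.even_bound hl i
    rw [show j + 3 - 1 = j + 2 by omega, show j + 3 - 3 = j by omega] at hcard
    have h1 : (X.card : ℝ) < LinesES.ESL (j + 3) (2 * (i + 2) + 2) := by exact_mod_cast hX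
    have h2 := (Nat.cast_le (α := ℝ)).2 hcard
    push_cast at h2 ⊢
    linarith
  · obtain ⟨X, hX, hcard⟩ := LinesES.odd_bound hl i
    rw [show j + 3 - 1 = j + 2 by omega, show j + 3 - 3 = j by omega] at hcard
    have h1 : (X.card : ℝ) < LinesES.ESL (j + 3) (2 * (i + 2) + 1) := by exact_mod_cast hX
    have h2 := (Nat.cast_le (α := ℝ)).2 hcard
    push_cast at h2 ⊢
    linarith
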